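/- Let $G$ be a finite simple graph with maximum degree $\Delta\ge 3$. Then $G$ is $\lceil\frac13(\Delta+2)\rceil$-choosable with clustering $\lceil\frac{19}{2}\Delta\rceil-17$. That is, for every assignment $L$ of a set $L(v)$ of colours to each vertex $v$ of $G$ with $|L(v)|\ge\lceil\frac13(\Delta+2)\rceil$ for all $v\in V(G)$, there is a (not necessarily proper) colouring $\phi$ of $V(G)$ with $\phi(v)\in L(v)$ for every $v\in V(G)$, such that every connected component of the monochromatic subgraph (the spanning subgraph of $G$ whose edges are the edges $uv$ of $G$ with $\phi(u)=\phi(v)$) has at most $\lceil\frac{19}{2}\Delta\rceil-17$ vertices. -/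

import Mathlib

universe u w

namespace ClusteredChoosability

/-- The monochromatic subgraph of `G` under the (not necessarily proper) colouring `φ`: the spanning
subgraph consisting of the edges of `G` whose endpoints have the same colour. -/
def monochromaticSubgraph {V α : Type*} (G : SimpleGraph V) (φ : V → α) : SimpleGraph V where
  Adj u v := G.Adj u v ∧ φ u = φ v
  symm := ⟨fun _ _ h => ⟨h.1.symm, h.2.symm⟩⟩
  loopless := ⟨fun _ h => h.1.ne rfl⟩

/-- The colouring `φ` of `G` has clustering `c`: every connected component of the monochromatic
subgraph has at most `c` vertices. -/
def HasClustering {V α : Type*} (G : SimpleGraph V) (φ : V → α) (c : ℕ) : Prop :=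
  ∀ C : (monochromaticSubgraph G φ).ConnectedComponent, C.supp.encard ≤ c

/-- `L` is a `k`-list-assignment: every vertex gets a (possibly infinite) set of at least `k`
colours. -/
def IsListAssignment {V α : Type*} (k : ℕ) (L : V → Set α) : Prop :=
  ∀ v, (k : ℕ∞) ≤ (L v).encard

/-- `φ` is an `L`-colouring: every vertex gets a colour from its list. -/
def IsListColouring {V α : Type*} (L : V → Set α) (φ : V → α) : Prop :=
  ∀ v, φ v ∈ L v

/-- `G` is `k`-choosable with clustering `c`: for every `k`-list-assignment `L`, with colours from
an arbitrary type, there is an `L`-colouring of `G` with clustering `c`. -/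
def ChoosableWithClustering {V : Type u} (G : SimpleGraph V) (k c : ℕ) : Prop :=
  ∀ (α : Type w) (L : V → Set α), IsListAssignment k L →
    ∃ φ : V → α, IsListColouring L φ ∧ HasClustering G φ c

end ClusteredChoosability

/-! Take an `L`-colouring `φ` with the fewest monochromatic edges and, among those, with the most
cyclic (2-regular) monochromatic components. For lists of size k with 3k ≥ Δ + 2, counting
neighbours by colour shows that a vertex has at most two neighbours of its own colour, and that if
it has two, another colour `τ v` of its list also occurs exactly twice around it. So monochromatic
components are paths and cycles. Giving an independent set of vertices of monochromatic degree two
their colours `τ` keeps the colouring optimal, so all degrees stay at most two.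

Such a recolouring is used to cut the components with more than 4s vertices, where s ≥ 2(Δ - 2k).
They are divided into blocks of 2s positions, the odd ones being candidates. By optimality a
candidate is adjacent to at most Δ - 2k others (`card_neighbours_le`), so Haxell's theorem
(`exists_independent_transversal`) gives an independent set Y of candidates that meets every block.

Recolouring y removes it from its component but joins its two arms, the neighbours coloured `τ y`,
which have monochromatic degree at most one. Long chains could arise through small components, which
are not cut. The `linkGraph` on Y records this; its degrees are at most two. Therefore only a subset
X of Y is recoloured: blocks are paired, X meets every pair, and Hall's theorem
(`exists_representatives`) chooses X so that it induces a matching in the link graph.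

That choice needs a link graph without cycles. Recolouring a whole link cycle would create a cyclic
monochromatic component, so maximality and Hall's theorem match the link cycles to distinct old
cyclic components that they meet (`Setting.exists_cyclic_representatives`). One vertex of each link
cycle is then dropped by leaving its block unpaired (`exists_selection`).

After recolouring, a component is a piece between cuts, or one vertex of X with two end pieces, or
two linked vertices of X with their surroundings. Each has at most 14s + 2 vertices. -/

namespace ClusteredChoosability

open scoped Classical

/-! ### Independent transversals: Haxell's theorem -/

/-- `f` picks from every class in `J` a vertex of `U`, and no two of the picked vertices are
adjacent. The classes are the fibres of `cls`. -/
def IsTransversal {W ι : Type*} (H : SimpleGraph W) (cls : W → ι) (U : Finset W) (J : Finset ι)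
    (f : ι → W) : Prop :=
  (∀ i ∈ J, f i ∈ U ∧ cls (f i) = i) ∧ ∀ i ∈ J, ∀ j ∈ J, ¬ H.Adj (f i) (f j)

/-- If the classes in `J` have no independent transversal while those in `J \ {a}` have one, then
the union of some classes, one of them `a`, is dominated by few vertices. -/
theorem exists_dominating_of_no_transversal {W ι : Type*} [Fintype W] (n : ℕ) :
    ∀ (J : Finset ι), J.card = n → ∀ (m : ℕ) (H : SimpleGraph W),
      (Finset.univ.filter fun p : W × W => H.Adj p.1 p.2).card = m →
      ∀ (cls : W → ι) (U : Finset W) (a : ι), a ∈ J →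
      (¬ ∃ f, IsTransversal H cls U J f) → (∃ f, IsTransversal H cls U (J.erase a) f) →
      ∃ S ⊆ J, a ∈ S ∧ ∃ D : Finset W, D.card + 2 ≤ 2 * S.card ∧
        ∀ w ∈ U, cls w ∈ S → ∃ d ∈ D, H.Adj d w := by
  induction n using Nat.strong_induction_on with
  | _ n ihn =>
  intro J hJ m
  induction m using Nat.strong_induction_on with
  | _ m ihm =>
  intro H hm cls U a ha hno hyes
  obtain ⟨f0, hf0, hf0'⟩ := hyes
  by_cases hex : ∃ x ∈ U, ∃ y ∈ U, cls x = a ∧ cls y ∈ J ∧ cls y ≠ a ∧ H.Adj x y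
  · obtain ⟨x, hx, y, hy, hxa, hyJ, hya, hxy⟩ := hex
    -- If deleting xy creates no transversal, the inner induction on the number of edges applies.
    -- Otherwise every new transversal uses both x and y.
    set H1 := H.deleteEdges {s(x, y)} with hH1
    have hle : ∀ u v, H1.Adj u v → H.Adj u v := fun u v h => by
      rw [hH1, SimpleGraph.deleteEdges_adj] at h; exact h.1
    by_cases hT : ∃ f, IsTransversal H1 cls U J f
    · obtain ⟨T, hT1, hT2⟩ := hT
      have hkey : ∀ u v, H.Adj u v → ¬ H1.Adj u v → (u = x ∧ v = y) ∨ (u = y ∧ v = x) := by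
        intro u v h h'
        rw [hH1, SimpleGraph.deleteEdges_adj] at h'
        have : s(u, v) = s(x, y) := by
          by_contra hc; exact h' ⟨h, hc⟩
        simpa using this
      have hTxy : T a = x ∧ T (cls y) = y := by
        by_contra hc
        apply hno
        refine ⟨T, hT1, fun i hi j hj hij => ?_⟩
        rcases hkey _ _ hij (hT2 i hi j hj) with ⟨h1, h2⟩ | ⟨h1, h2⟩
        · have e1 := (hT1 i hi).2
          have e2 := (hT1 j hj).2
          rw [h1, hxa] at e1
          rw [h2] at e2
          subst e1 e2
          exact hc ⟨h1, h2⟩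
        · have e1 := (hT1 i hi).2
          have e2 := (hT1 j hj).2
          rw [h1] at e1
          rw [h2, hxa] at e2
          subst e1 e2
          exact hc ⟨h2, h1⟩
      -- Merge the class of y into `a` and discard the neighbours of x and y: the outer induction
      -- applies to this system with one class fewer.
      set cls' : W → ι := fun w => if cls w = cls y then a else cls w with hcls'
      set U' := U.filter fun w => ¬ H.Adj x w ∧ ¬ H.Adj y w with hU'
      have hU'mem : ∀ w, w ∈ U' ↔ w ∈ U ∧ ¬ H.Adj x w ∧ ¬ H.Adj y w := by
        intro w; simp [hU']
      have hcard : (J.erase (cls y)).card < n := by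
        rw [Finset.card_erase_of_mem hyJ, hJ]
        have : 0 < J.card := Finset.card_pos.2 ⟨_, ha⟩
        omega
      have haJ' : a ∈ J.erase (cls y) := Finset.mem_erase.2 ⟨hya.symm, ha⟩
      have hno' : ¬ ∃ f, IsTransversal H cls' U' (J.erase (cls y)) f := by
        rintro ⟨g, hg1, hg2⟩
        have hgother : ∀ i ∈ J, i ≠ a → i ≠ cls y → g i ∈ U' ∧ cls (g i) = i := by
          intro i hi hia hiy
          have h := hg1 i (Finset.mem_erase.2 ⟨hiy, hi⟩)
          refine ⟨h.1, ?_⟩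
          have h2 := h.2
          simp only [hcls'] at h2
          split_ifs at h2 with hc
          · exact absurd h2.symm hia
          · exact h2
        have hga := hg1 a haJ'
        have hgaU := (hU'mem _).1 hga.1
        have hga2 : cls (g a) = cls y ∨ cls (g a) = a := by
          have h2 := hga.2
          simp only [hcls'] at h2
          split_ifs at h2 with hc
          · exact Or.inl hc
          · exact Or.inr h2
        apply hno
        -- The vertex `g a` serves one of the two merged classes; x or y serves the other, since
        -- `U'` contains no neighbours of x and y.
        rcases hga2 with hc | hc
        · refine ⟨fun i => if i = cls y then g a else if i = a then x else g i, ?_, ?_⟩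
          · intro i hi
            dsimp only
            split_ifs with h1 h2
            · exact ⟨hgaU.1, hc.trans h1.symm⟩
            · exact ⟨hx, hxa.trans h2.symm⟩
            · have := hgother i hi h2 h1
              exact ⟨((hU'mem _).1 this.1).1, this.2⟩
          · intro i hi j hj
            dsimp only
            have aux : ∀ i ∈ J, i ≠ cls y → ¬ H.Adj x (g i) := fun i hi h =>
              ((hU'mem _).1 (hg1 i (Finset.mem_erase.2 ⟨h, hi⟩)).1).2.1
            split_ifs with h1 h2 h2 h3 h4 h5 h5 h6
            · exact H.irrefl
            · exact fun h => hgaU.2.1 h.symm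
            · exact hg2 _ haJ' _ (Finset.mem_erase.2 ⟨by assumption, hj⟩)
            · exact hgaU.2.1
            · exact H.irrefl
            · exact aux j hj h4
            · exact hg2 _ (Finset.mem_erase.2 ⟨h1, hi⟩) _ haJ'
            · exact fun h => aux i hi h1 h.symm
            · exact hg2 _ (Finset.mem_erase.2 ⟨h1, hi⟩) _ (Finset.mem_erase.2 ⟨h5, hj⟩)
        · refine ⟨fun i => if i = cls y then y else g i, ?_, ?_⟩
          · intro i hi
            dsimp only
            split_ifs with h1
            · exact ⟨hy, h1.symm⟩
            · by_cases h2 : i = a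
              · subst h2; exact ⟨hgaU.1, hc⟩
              · have := hgother i hi h2 h1
                exact ⟨((hU'mem _).1 this.1).1, this.2⟩
          · intro i hi j hj
            dsimp only
            have aux : ∀ i ∈ J, i ≠ cls y → ¬ H.Adj y (g i) := fun i hi h =>
              ((hU'mem _).1 (hg1 i (Finset.mem_erase.2 ⟨h, hi⟩)).1).2.2
            split_ifs with h1 h2 h2
            · exact H.irrefl
            · exact aux j hj h2
            · exact fun h => aux i hi h1 h.symm
            · exact hg2 _ (Finset.mem_erase.2 ⟨h1, hi⟩) _ (Finset.mem_erase.2 ⟨h2, hj⟩)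
      -- The rest of `T` survives in `U'`, as xy is the only deleted edge.
      have hyes' : ∃ f, IsTransversal H cls' U' ((J.erase (cls y)).erase a) f := by
        have hmem : ∀ i ∈ (J.erase (cls y)).erase a, i ∈ J ∧ i ≠ a ∧ i ≠ cls y := by
          intro i hi
          simp only [Finset.mem_erase] at hi
          exact ⟨hi.2.2, hi.1, hi.2.1⟩
        have hnx : ∀ i, i ∈ J → i ≠ a → i ≠ cls y → T i ≠ x ∧ T i ≠ y := by
          intro i hi h1 h2
          refine ⟨fun h => h1 ?_, fun h => h2 ?_⟩
          · rw [← (hT1 i hi).2, h, hxa]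
          · rw [← (hT1 i hi).2, h]
        refine ⟨T, fun i hi => ?_, fun i hi j hj hij => ?_⟩
        · obtain ⟨hiJ, hia, hiy⟩ := hmem i hi
          refine ⟨(hU'mem _).2 ⟨(hT1 i hiJ).1, fun h => ?_, fun h => ?_⟩, ?_⟩
          · have h' := hT2 a ha i hiJ
            rw [hTxy.1] at h'
            rcases hkey _ _ h h' with h3 | h3
            · exact (hnx i hiJ hia hiy).2 h3.2
            · exact (hnx i hiJ hia hiy).1 h3.2
          · have h' := hT2 _ hyJ i hiJ
            rw [hTxy.2] at h'
            rcases hkey _ _ h h' with h3 | h3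
            · exact (hnx i hiJ hia hiy).2 h3.2
            · exact (hnx i hiJ hia hiy).1 h3.2
          · simp only [hcls', (hT1 i hiJ).2, if_neg hiy]
        · obtain ⟨hiJ, hia, hiy⟩ := hmem i hi
          obtain ⟨hjJ, -, -⟩ := hmem j hj
          rcases hkey _ _ hij (hT2 i hiJ j hjJ) with h3 | h3
          · exact (hnx i hiJ hia hiy).1 h3.1
          · exact (hnx i hiJ hia hiy).2 h3.1
      obtain ⟨S, hS, haS, D, hD, hdom⟩ :=
        ihn _ hcard (J.erase (cls y)) rfl _ H rfl cls' U' a haJ' hno' hyes'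
      have hyS : cls y ∉ S := fun h => (Finset.mem_erase.1 (hS h)).1 rfl
      -- The discarded vertices are dominated by x and y: two more dominating vertices for one more
      -- class.
      refine ⟨insert (cls y) S, ?_, Finset.mem_insert_of_mem haS, insert x (insert y D), ?_, ?_⟩
      · intro i hi
        rcases Finset.mem_insert.1 hi with h | h
        · exact h ▸ hyJ
        · exact Finset.mem_of_mem_erase (hS h)
      · rw [Finset.card_insert_of_notMem hyS]
        have h1 := Finset.card_insert_le x (insert y D)
        have h2 := Finset.card_insert_le y D
        omega
      · intro w hw hwS
        by_cases h1 : H.Adj x w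
        · exact ⟨x, by simp, h1⟩
        by_cases h2 : H.Adj y w
        · exact ⟨y, by simp, h2⟩
        obtain ⟨d, hd, hdw⟩ := hdom w ((hU'mem w).2 ⟨hw, h1, h2⟩) (by
          simp only [hcls']
          split_ifs with h
          · exact haS
          · exact (Finset.mem_insert.1 hwS).resolve_left h)
        exact ⟨d, by simp [hd], hdw⟩
    · have hlt : (Finset.univ.filter fun p : W × W => H1.Adj p.1 p.2).card < m := by
        rw [← hm]
        apply Finset.card_lt_card
        refine Finset.ssubset_iff_subset_ne.2 ⟨?_, fun h => ?_⟩
        · intro p hp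
          simp only [Finset.mem_filter, Finset.mem_univ, true_and] at hp ⊢
          exact hle _ _ hp
        · have : (x, y) ∈ Finset.univ.filter fun p : W × W => H1.Adj p.1 p.2 := by
            rw [h]; simpa using hxy
          simp [hH1] at this
      obtain ⟨S, hS, haS, D, hD, hdom⟩ := ihm _ (lt_of_eq_of_lt (by congr) hlt) H1 rfl cls U a ha hT
        ⟨f0, hf0, fun i hi j hj h => hf0' i hi j hj (hle _ _ h)⟩
      exact ⟨S, hS, haS, D, hD, fun w hw hwS => by
        obtain ⟨d, hd, h⟩ := hdom w hw hwS
        exact ⟨d, hd, hle _ _ h⟩⟩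
  -- A vertex of class `a` without neighbours in the other classes would extend `f0`. So the class
  -- is empty in `U`, and nothing has to be dominated.
  · have hempty : ∀ w ∈ U, cls w ≠ a := by
      intro w hw hwa
      apply hno
      have aux : ∀ i ∈ J, i ≠ a → ¬ H.Adj w (f0 i) := by
        intro i hi hia h
        have := hf0 i (Finset.mem_erase.2 ⟨hia, hi⟩)
        exact hex ⟨w, hw, f0 i, this.1, hwa, by rwa [this.2], by rwa [this.2], h⟩
      refine ⟨fun i => if i = a then w else f0 i, fun i hi => ?_, fun i hi j hj => ?_⟩
      · dsimp only
        split_ifs with h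
        · exact ⟨hw, hwa.trans h.symm⟩
        · exact hf0 i (Finset.mem_erase.2 ⟨h, hi⟩)
      · dsimp only
        split_ifs with h1 h2 h2
        · exact H.irrefl
        · exact aux j hj h2
        · exact fun h => aux i hi h1 h.symm
        · exact hf0' i (Finset.mem_erase.2 ⟨h1, hi⟩) j (Finset.mem_erase.2 ⟨h2, hj⟩)
    exact ⟨{a}, by simpa using ha, by simp, ∅, by simp, fun w hw h =>
      absurd (Finset.mem_singleton.1 h) (hempty w hw)⟩

/-- Haxell's theorem: if the maximum degree is at most `d`, then nonempty classes of size at least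
`2 * d` have an independent transversal. -/
theorem exists_independent_transversal {W ι : Type*} [Fintype W] (H : SimpleGraph W)
    (cls : W → ι) (U : Finset W) (d : ℕ)
    (hd : ∀ w, (Finset.univ.filter fun u => H.Adj w u).card ≤ d) (J : Finset ι)
    (hJ : ∀ i ∈ J, (∃ w ∈ U, cls w = i) ∧ 2 * d ≤ (U.filter fun w => cls w = i).card)
    (hW : Nonempty W) :
    ∃ f, IsTransversal H cls U J f := by
  induction J using Finset.induction_on with
  | empty => exact ⟨fun _ => hW.some, by simp [IsTransversal]⟩
  | insert a J ha ih =>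
    by_contra hno
    obtain ⟨f, hf⟩ := ih fun i hi => hJ i (Finset.mem_insert_of_mem hi)
    obtain ⟨S, hS, haS, D, hD, hdom⟩ := exists_dominating_of_no_transversal _ (insert a J) rfl _ H
      rfl cls U a (Finset.mem_insert_self _ _) hno
      ⟨f, by rwa [Finset.erase_insert ha]⟩
    have h1 : (U.filter fun w => cls w ∈ S).card ≤ D.card * d := by
      have hsub : (U.filter fun w => cls w ∈ S) ⊆
          D.biUnion fun x => Finset.univ.filter fun u => H.Adj x u := by
        intro w hw
        simp only [Finset.mem_filter] at hw
        obtain ⟨x, hx, hxw⟩ := hdom w hw.1 hw.2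
        simp only [Finset.mem_biUnion, Finset.mem_filter, Finset.mem_univ, true_and]
        exact ⟨x, hx, hxw⟩
      exact (Finset.card_le_card hsub).trans (Finset.card_biUnion_le_card_mul _ _ _ fun x _ => hd x)
    have h2 : S.card * (2 * d) ≤ (U.filter fun w => cls w ∈ S).card := by
      rw [Finset.card_eq_sum_card_fiberwise (f := cls) (t := S)
        (fun w hw => by simpa using (Finset.mem_filter.1 hw).2)]
      rw [← smul_eq_mul]
      apply Finset.card_nsmul_le_sum
      intro i hi
      refine (hJ i (hS hi)).2.trans (Finset.card_le_card ?_)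
      intro w hw
      simp only [Finset.mem_filter] at hw ⊢
      exact ⟨⟨hw.1, hw.2 ▸ hi⟩, hw.2⟩
    -- The counts give 2d|S| ≤ |D|d ≤ (2|S| - 2)d, absurd for d > 0. For d = 0 the nonemptiness of
    -- class `a` is used instead.
    rcases Nat.eq_zero_or_pos d with h0 | h0
    · obtain ⟨w, hw, hwa⟩ := (hJ a (Finset.mem_insert_self _ _)).1
      have : w ∈ U.filter fun w => cls w ∈ S := by simp [hw, hwa, haS]
      have := Finset.card_pos.2 ⟨w, this⟩
      rw [h0] at h1
      omega
    · have h3 : (D.card + 2) * d ≤ 2 * S.card * d := Nat.mul_le_mul_right _ hD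
      nlinarith

/-! ### Representatives from Hall's theorem -/

/-- If the fibres of `κ` on `Y` have at least two elements and those of `γ` at most two, then there
is a set of representatives for `κ` on which `γ` is injective. -/
theorem exists_representatives {W A B : Type*} (Y : Finset W) (κ : W → A) (γ : W → B)
    (hκ : ∀ y ∈ Y, ∃ y' ∈ Y, y' ≠ y ∧ κ y' = κ y)
    (hγ : ∀ b, (Y.filter fun y => γ y = b).card ≤ 2) :
    ∃ X ⊆ Y, (∀ y ∈ Y, ∃ x ∈ X, κ x = κ y) ∧ ∀ x ∈ X, ∀ x' ∈ X, γ x = γ x' → x = x' := by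
  let t : {a // a ∈ Y.image κ} → Finset B := fun a => (Y.filter fun y => κ y = a).image γ
  -- The classes in `s` contain at least 2|s| elements in all, and `γ` takes each value at most
  -- twice.
  have hall : ∀ s : Finset {a // a ∈ Y.image κ}, s.card ≤ (s.biUnion t).card := by
    intro s
    set R := Y.filter fun y => ∃ a ∈ s, κ y = a with hR
    have h1 : R.card ≤ 2 * (s.biUnion t).card := by
      have himg : R.image γ = s.biUnion t := by
        ext b
        simp only [hR, t, Finset.mem_image, Finset.mem_filter, Finset.mem_biUnion]
        constructor
        · rintro ⟨y, ⟨hy, a, ha, hya⟩, rfl⟩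
          exact ⟨a, ha, y, ⟨hy, hya⟩, rfl⟩
        · rintro ⟨a, ha, y, ⟨hy, hya⟩, rfl⟩
          exact ⟨y, ⟨hy, a, ha, hya⟩, rfl⟩
      rw [← himg]
      apply Finset.card_le_mul_card_image
      intro b _
      refine (Finset.card_le_card ?_).trans (hγ b)
      intro y hy
      simp only [hR, Finset.mem_filter] at hy ⊢
      exact ⟨hy.1.1, hy.2⟩
    have h2 : s.card * 2 ≤ R.card := by
      have hmap : Set.MapsTo κ (R : Set W) (s.image Subtype.val : Finset A) := by
        intro y hy
        have hy' := (Finset.mem_filter.1 hy).2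
        obtain ⟨a, ha, hya⟩ := hy'
        rw [hya]
        exact Finset.mem_coe.2 (Finset.mem_image_of_mem _ ha)
      rw [Finset.card_eq_sum_card_fiberwise hmap,
        ← Finset.card_image_of_injective s Subtype.val_injective, ← smul_eq_mul]
      apply Finset.card_nsmul_le_sum
      intro a ha
      obtain ⟨⟨a, haY⟩, has, rfl⟩ := Finset.mem_image.1 ha
      obtain ⟨y, hy, hya⟩ := Finset.mem_image.1 haY
      obtain ⟨y', hy', hne, hyy⟩ := hκ y hy
      have : ({y, y'} : Finset W) ⊆ R.filter fun y => κ y = a := by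
        intro w hw
        simp only [Finset.mem_insert, Finset.mem_singleton] at hw
        simp only [hR, Finset.mem_filter]
        rcases hw with rfl | rfl
        · exact ⟨⟨hy, ⟨a, haY⟩, has, hya⟩, hya⟩
        · exact ⟨⟨hy', ⟨a, haY⟩, has, hyy.trans hya⟩, hyy.trans hya⟩
      have h := Finset.card_le_card this
      rwa [Finset.card_pair hne.symm] at h
    omega
  obtain ⟨f, hf, hft⟩ := (Finset.all_card_le_biUnion_card_iff_exists_injective t).1 hall
  have hch : ∀ a : {a // a ∈ Y.image κ}, ∃ y ∈ Y, κ y = a ∧ γ y = f a := by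
    intro a
    obtain ⟨y, hy, hya⟩ := Finset.mem_image.1 (hft a)
    exact ⟨y, (Finset.mem_filter.1 hy).1, (Finset.mem_filter.1 hy).2, hya⟩
  choose g hgY hgκ hgγ using hch
  refine ⟨Finset.univ.image g, ?_, ?_, ?_⟩
  · intro x hx
    obtain ⟨a, -, rfl⟩ := Finset.mem_image.1 hx
    exact hgY a
  · intro y hy
    exact ⟨g ⟨κ y, Finset.mem_image_of_mem _ hy⟩, Finset.mem_image_of_mem _ (Finset.mem_univ _),
      hgκ _⟩
  · intro x hx x' hx' h
    obtain ⟨a, -, rfl⟩ := Finset.mem_image.1 hx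
    obtain ⟨a', -, rfl⟩ := Finset.mem_image.1 hx'
    rw [hgγ, hgγ] at h
    rw [hf h]

/-! ### Numbering the components of graphs of maximum degree two -/

/-- The degree of `v` in `H`, with no decidability instances around. -/
noncomputable def valency {V : Type*} [Fintype V] (H : SimpleGraph V) (v : V) : ℕ :=
  (Finset.univ.filter fun u => H.Adj v u).card

/-- The vertex set of the connected component of `v`. -/
noncomputable def comp {V : Type*} [Fintype V] (H : SimpleGraph V) (v : V) : Finset V :=
  Finset.univ.filter fun u => H.Reachable v u

section Enumeration

variable {V : Type*} [Fintype V] {H : SimpleGraph V}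

@[simp]
theorem mem_comp {u v : V} : u ∈ comp H v ↔ H.Reachable v u := by simp [comp]

theorem comp_eq_of_reachable {u v : V} (h : H.Reachable u v) : comp H u = comp H v := by
  ext w
  simp only [mem_comp]
  exact ⟨fun h' => h.symm.trans h', fun h' => h.trans h'⟩

theorem reachable_iff_comp_eq {u v : V} : H.Reachable u v ↔ comp H u = comp H v :=
  ⟨comp_eq_of_reachable, fun h => by
    have : v ∈ comp H u := by rw [h]; simp
    simpa using this⟩

theorem two_le_valency {v a b : V} (ha : H.Adj v a) (hb : H.Adj v b) (hab : a ≠ b) :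
    2 ≤ valency H v := by
  rw [← Finset.card_pair hab]
  apply Finset.card_le_card
  intro x hx
  simp only [Finset.mem_insert, Finset.mem_singleton] at hx
  rcases hx with rfl | rfl <;> simpa

theorem three_le_valency {v a b c : V} (ha : H.Adj v a) (hb : H.Adj v b) (hc : H.Adj v c)
    (hab : a ≠ b) (hac : a ≠ c) (hbc : b ≠ c) : 3 ≤ valency H v := by
  have h : ({a, b, c} : Finset V).card = 3 := by
    rw [Finset.card_insert_of_notMem (by simp [hab, hac]), Finset.card_pair hbc]
  rw [← h]
  apply Finset.card_le_card
  intro x hx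
  simp only [Finset.mem_insert, Finset.mem_singleton] at hx
  rcases hx with rfl | rfl | rfl <;> simpa

/-- A set that contains `v` and is closed under adjacency contains the component of `v`. -/
theorem mem_of_reachable_of_closed {V : Type*} {H : SimpleGraph V} {S : Set V}
    (hS : ∀ u ∈ S, ∀ w, H.Adj u w → w ∈ S) {v w : V}
    (hv : v ∈ S) (h : H.Reachable v w) : w ∈ S := by
  obtain ⟨p⟩ := h
  induction p with
  | nil => exact hv
  | cons hadj _ ih => exact ih (hS _ hv _ hadj)

/-- The positions `pos` number the vertices of each component along a path or a cycle. -/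
structure IsEnumeration (H : SimpleGraph V) (pos : V → ℕ) : Prop where
  inj : ∀ u v, H.Reachable u v → pos u = pos v → u = v
  lt : ∀ u, pos u < (comp H u).card
  surj : ∀ u, ∀ i < (comp H u).card, ∃ v, H.Reachable u v ∧ pos v = i
  adj_succ : ∀ u v, H.Reachable u v → pos v = pos u + 1 → H.Adj u v
  of_adj : ∀ u v, H.Adj u v → pos v = pos u + 1 ∨ pos u = pos v + 1 ∨
    (pos u = 0 ∧ pos v + 1 = (comp H u).card) ∨ (pos v = 0 ∧ pos u + 1 = (comp H u).card)

/-- A longest path fills the component: a neighbour off the path would extend it at an end, or be a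
third neighbour of an inner vertex. -/
theorem exists_path_of_valency_le_two (hH : ∀ v, valency H v ≤ 2) (v : V) :
    ∃ f : ℕ → V, (∀ i < (comp H v).card, ∀ j < (comp H v).card, f i = f j → i = j) ∧
      (∀ i < (comp H v).card, H.Reachable v (f i)) ∧
      (∀ i, i + 1 < (comp H v).card → H.Adj (f i) (f (i + 1))) ∧
      (∀ w, H.Reachable v w → ∃ i < (comp H v).card, f i = w) := by
  let P : ℕ → Prop := fun n => ∃ f : ℕ → V, (∀ i < n, ∀ j < n, f i = f j → i = j) ∧
    (∀ i < n, H.Reachable v (f i)) ∧ (∀ i, i + 1 < n → H.Adj (f i) (f (i + 1)))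
  have hbound : ∀ n, P n → n ≤ (comp H v).card := by
    rintro n ⟨f, hf, hr, -⟩
    calc n = (Finset.range n).card := (Finset.card_range n).symm
      _ ≤ _ := Finset.card_le_card_of_injOn f (fun i hi => by
        simpa using hr i (Finset.mem_range.1 hi)) (fun i hi j hj h =>
          hf i (by simpa using hi) j (by simpa using hj) h)
  have h1 : P 1 := ⟨fun _ => v, fun i hi j hj _ => by omega, fun _ _ => .refl _,
    fun i hi => by omega⟩
  obtain ⟨n, hn, hmax⟩ : ∃ n, P n ∧ ∀ m, P m → m ≤ n := by
    have hne : ((Finset.range ((comp H v).card + 1)).filter P).Nonempty :=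
      ⟨1, by simp only [Finset.mem_filter, Finset.mem_range]
             exact ⟨by have := hbound 1 h1; omega, h1⟩⟩
    obtain ⟨n, hn, hmax⟩ := Finset.exists_max_image _ id hne
    simp only [Finset.mem_filter, Finset.mem_range, id] at hn hmax
    exact ⟨n, hn.2, fun m hm => hmax m ⟨by have := hbound m hm; omega, hm⟩⟩
  have hn1 : 1 ≤ n := hmax 1 h1
  obtain ⟨f, hf, hr, ha⟩ := hn
  have hclosed : ∀ u ∈ {w | ∃ i < n, f i = w}, ∀ w, H.Adj u w → w ∈ {w | ∃ i < n, f i = w} := by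
    rintro _ ⟨i, hi, rfl⟩ w hw
    by_contra hnw
    have hnw' : ∀ j < n, f j ≠ w := fun j hj h => hnw ⟨j, hj, h⟩
    have hrw : H.Reachable v w := (hr i hi).trans hw.reachable
    rcases Nat.eq_zero_or_pos i with h0 | h0
    · have : P (n + 1) := by
        refine ⟨fun j => if j = 0 then w else f (j - 1), ?_, ?_, ?_⟩
        · intro j hj l hl
          dsimp only
          split_ifs with h2 h3 h3
          · intro; omega
          · intro h; exact absurd h.symm (hnw' _ (by omega))
          · intro h; exact absurd h (hnw' _ (by omega))
          · intro h
            have := hf _ (by omega) _ (by omega) h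
            omega
        · intro j hj
          dsimp only
          split_ifs
          · exact hrw
          · exact hr _ (by omega)
        · intro j hj
          rcases Nat.eq_zero_or_pos j with h2 | h2
          · subst h2 h0; exact hw.symm
          · have := ha (j - 1) (by omega)
            rw [show j - 1 + 1 = j by omega] at this
            simpa [h2.ne'] using this
      have := hmax _ this
      omega
    · by_cases hl : i + 1 = n
      · have : P (n + 1) := by
          refine ⟨fun j => if j = n then w else f j, ?_, ?_, ?_⟩
          · intro j hj l hl
            dsimp only
            split_ifs with h2 h3 h3
            · intro; omega
            · intro h; exact absurd h.symm (hnw' _ (by omega))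
            · intro h; exact absurd h (hnw' _ (by omega))
            · intro h
              exact hf _ (by omega) _ (by omega) h
          · intro j hj
            dsimp only
            split_ifs
            · exact hrw
            · exact hr _ (by omega)
          · intro j hj
            dsimp only
            rw [if_neg (by omega)]
            split_ifs with h2
            · rwa [show j = i by omega]
            · exact ha _ (by omega)
        have := hmax _ this
        omega
      · have e1 := ha (i - 1) (by omega)
        rw [show i - 1 + 1 = i by omega] at e1
        have e2 := ha i (by omega)
        have := three_le_valency e1.symm e2 hw
          (fun h => by have := hf _ (by omega) _ (by omega) h; omega)
          (hnw' _ (by omega)) (hnw' _ (by omega))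
        have := hH (f i)
        omega
  have hsurj : ∀ w, H.Reachable v w → ∃ i < n, f i = w := by
    intro w hw
    have h0 : f 0 ∈ {w | ∃ i < n, f i = w} := ⟨0, hn1, rfl⟩
    exact mem_of_reachable_of_closed hclosed h0 ((hr 0 hn1).symm.trans hw)
  have hcard : n = (comp H v).card := by
    apply le_antisymm (hbound n ⟨f, hf, hr, ha⟩)
    have : comp H v ⊆ (Finset.range n).image f := by
      intro w hw
      obtain ⟨i, hi, h⟩ := hsurj w (by simpa using hw)
      exact Finset.mem_image.2 ⟨i, Finset.mem_range.2 hi, h⟩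
    simpa using (Finset.card_le_card this).trans Finset.card_image_le
  subst hcard
  exact ⟨f, hf, hr, ha, hsurj⟩

theorem exists_enumeration (hH : ∀ v, valency H v ≤ 2) : ∃ pos, IsEnumeration H pos := by
  choose f hf hr ha hs using exists_path_of_valency_le_two hH
  -- All vertices of a component must be numbered along the same path, so the path is taken at a
  -- fixed representative.
  let rep : V → V := fun v => (H.connectedComponentMk v).out
  have hrep : ∀ v, H.Reachable (rep v) v := fun v =>
    SimpleGraph.ConnectedComponent.exact (Quot.out_eq (H.connectedComponentMk v))
  have hrepeq : ∀ u v, H.Reachable u v → rep u = rep v := fun u v h => by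
    simp only [rep]
    rw [SimpleGraph.ConnectedComponent.sound h]
  have hcr : ∀ v, (comp H (rep v)).card = (comp H v).card := fun v => by
    rw [comp_eq_of_reachable (hrep v)]
  have hex : ∀ v, ∃ i, i < (comp H (rep v)).card ∧ f (rep v) i = v := fun v =>
    hs (rep v) v (hrep v)
  choose pos hlt hpos using hex
  have key : ∀ u v, H.Reachable u v → f (rep u) (pos v) = v := fun u v h => by
    rw [hrepeq u v h, hpos]
  refine ⟨pos, ⟨?_, ?_, ?_, ?_, ?_⟩⟩
  · intro u v h he
    rw [← hpos u, ← key u v h, he]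
  · intro u
    rw [← hcr]; exact hlt u
  · intro u i hi
    rw [← hcr] at hi
    have hreach : H.Reachable u (f (rep u) i) := (hrep u).symm.trans (hr _ i hi)
    refine ⟨_, hreach, ?_⟩
    have h2 := hlt (f (rep u) i)
    rw [← hrepeq _ _ hreach] at h2
    exact hf (rep u) _ h2 _ hi (key u _ hreach)
  · intro u v h he
    have h2 := hlt v
    rw [← hrepeq u v h] at h2
    have := ha (rep u) (pos u) (by omega)
    rwa [hpos, ← he, key u v h] at this
  · intro u v h
    have hreach := h.reachable
    have hv := hlt v
    rw [← hrepeq u v hreach] at hv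
    have hu := hlt u
    rw [← hcr u]
    by_contra hcon
    push Not at hcon
    obtain ⟨c1, c2, c3, c4⟩ := hcon
    have hne : pos u ≠ pos v := fun he => h.ne (by rw [← hpos u, ← key u v hreach, he])
    -- An inner vertex of the path already has two neighbours on it, so it is on no chord.
    have aux : ∀ x y, H.Adj (f (rep u) x) (f (rep u) y) → x < (comp H (rep u)).card →
        y < (comp H (rep u)).card → 0 < x → x + 1 < (comp H (rep u)).card → y ≠ x + 1 →
        x ≠ y + 1 → x ≠ y → False := by
      intro x y hxy hx hy h0 h1 h2 h3 h4
      have e1 := ha (rep u) (x - 1) (by omega)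
      rw [show x - 1 + 1 = x by omega] at e1
      have e2 := ha (rep u) x h1
      have := three_le_valency e1.symm e2 hxy
        (fun h => by have := hf _ _ (by omega) _ (by omega) h; omega)
        (fun h => by have := hf _ _ (by omega) _ (by omega) h; omega)
        (fun h => by have := hf _ _ (by omega) _ (by omega) h; omega)
      have := hH (f (rep u) x)
      omega
    have hadj : H.Adj (f (rep u) (pos u)) (f (rep u) (pos v)) := by
      rwa [hpos, key u v hreach]
    by_cases hu0 : 0 < pos u ∧ pos u + 1 < (comp H (rep u)).card
    · exact aux _ _ hadj hu hv hu0.1 hu0.2 c1 c2 hne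
    · by_cases hv0 : 0 < pos v ∧ pos v + 1 < (comp H (rep u)).card
      · exact aux _ _ hadj.symm hv hu hv0.1 hv0.2 c2 c1 hne.symm
      · by_cases h0 : pos u = 0
        · have := c3 h0
          omega
        · have := fun h => c4 h
          omega

end Enumeration

/-! ### Optimal colourings and recolouring at no cost -/

section Recolouring

variable {V α : Type*} [Fintype V] {G : SimpleGraph V}

/-- The number of neighbours of `v` that have colour `c`. -/
noncomputable def colourCount (G : SimpleGraph V) (φ : V → α) (v : V) (c : α) : ℕ :=
  (Finset.univ.filter fun u => G.Adj v u ∧ φ u = c).card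

/-- Twice the number of monochromatic edges. -/
noncomputable def energy (G : SimpleGraph V) (φ : V → α) : ℕ :=
  ∑ v, colourCount G φ v (φ v)

/-- `φ` is an `L`-colouring with the least number of monochromatic edges. -/
def IsOptimal (G : SimpleGraph V) (L : V → Finset α) (φ : V → α) : Prop :=
  (∀ v, φ v ∈ L v) ∧ ∀ ψ : V → α, (∀ v, ψ v ∈ L v) → energy G φ ≤ energy G ψ

/-- Give the vertices in `Y` the colour prescribed by `τ`. -/
noncomputable def recolour (φ τ : V → α) (Y : Finset V) : V → α :=
  fun v => if v ∈ Y then τ v else φ v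

theorem valency_monochromaticSubgraph (φ : V → α) (v : V) :
    valency (monochromaticSubgraph G φ) v = colourCount G φ v (φ v) := by
  unfold valency colourCount
  congr 1
  ext u
  simp only [Finset.mem_filter, Finset.mem_univ, true_and]
  exact and_congr_right fun _ => eq_comm

/-- Only edges at `v` change, and each is counted from both of its ends. The additive form avoids
truncated subtraction. -/
theorem energy_update (φ : V → α) (v : V) (c : α) :
    energy G (Function.update φ v c) + 2 * colourCount G φ v (φ v) =
      energy G φ + 2 * colourCount G φ v c := by
  have hsplit : ∀ ψ : V → α, energy G ψ =
      ∑ u ∈ Finset.univ.erase v, colourCount G ψ u (ψ u) + colourCount G ψ v (ψ v) := fun ψ =>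
    (Finset.sum_erase_add _ _ (Finset.mem_univ v)).symm
  have hself : colourCount G (Function.update φ v c) v (Function.update φ v c v) =
      colourCount G φ v c := by
    unfold colourCount
    congr 1
    ext u
    simp only [Finset.mem_filter, Finset.mem_univ, true_and, Function.update_self]
    refine and_congr_right fun h => ?_
    rw [Function.update_of_ne h.ne']
  have hother : ∀ u ∈ Finset.univ.erase v,
      colourCount G (Function.update φ v c) u (Function.update φ v c u) +
        (if G.Adj v u ∧ φ u = φ v then 1 else 0) =
      colourCount G φ u (φ u) + (if G.Adj v u ∧ φ u = c then 1 else 0) := by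
    intro u hu
    have huv : u ≠ v := (Finset.mem_erase.1 hu).1
    rw [Function.update_of_ne huv]
    unfold colourCount
    simp only [Finset.card_filter]
    rw [← Finset.sum_erase_add _ _ (Finset.mem_univ v),
      ← Finset.sum_erase_add (s := Finset.univ)
        (f := fun w => if G.Adj u w ∧ φ w = φ u then 1 else 0)
        (h := Finset.mem_univ v)]
    have : ∀ w ∈ Finset.univ.erase v,
        (if G.Adj u w ∧ Function.update φ v c w = φ u then 1 else 0) =
        (if G.Adj u w ∧ φ w = φ u then 1 else 0) := by
      intro w hw
      rw [Function.update_of_ne (Finset.mem_erase.1 hw).1]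
    rw [Finset.sum_congr rfl this, Function.update_self]
    simp only [G.adj_comm u v, eq_comm (a := c), eq_comm (a := φ v)]
    ring
  have hsum := Finset.sum_congr rfl hother
  rw [Finset.sum_add_distrib, Finset.sum_add_distrib] at hsum
  have hcount : ∀ d, ∑ u ∈ Finset.univ.erase v, (if G.Adj v u ∧ φ u = d then 1 else 0) =
      colourCount G φ v d := by
    intro d
    unfold colourCount
    rw [Finset.card_filter, ← Finset.sum_erase_add _ _ (Finset.mem_univ v)]
    simp
  rw [hcount, hcount] at hsum
  rw [hsplit φ, hsplit (Function.update φ v c), hself]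
  omega

theorem IsOptimal.colourCount_le {L : V → Finset α} {φ : V → α} (h : IsOptimal G L φ) {v : V}
    {c : α} (hc : c ∈ L v) : colourCount G φ v (φ v) ≤ colourCount G φ v c := by
  have h1 := energy_update (G := G) φ v c
  have h2 := h.2 (Function.update φ v c) fun u => by
    by_cases hu : u = v
    · subst hu; simpa using hc
    · rw [Function.update_of_ne hu]; exact h.1 u
  omega

theorem sum_colourCount_add (φ : V → α) (v : V) (S : Finset α) :
    ∑ c ∈ S, colourCount G φ v c +
      (Finset.univ.filter fun u => G.Adj v u ∧ φ u ∉ S).card = valency G v := by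
  unfold valency
  rw [← Finset.card_filter_add_card_filter_not (s := Finset.univ.filter fun u => G.Adj v u)
    (fun u => φ u ∈ S), Finset.filter_filter, Finset.filter_filter]
  congr 1
  rw [Finset.card_eq_sum_card_fiberwise (f := φ) (t := S)
    (fun w hw => by simpa using (Finset.mem_filter.1 hw).2.2)]
  refine Finset.sum_congr rfl fun c hc => ?_
  unfold colourCount
  congr 1
  ext u
  simp only [Finset.mem_filter, Finset.mem_univ, true_and]
  exact ⟨fun h => ⟨⟨h.1, h.2 ▸ hc⟩, h.2⟩, fun h => ⟨h.1.1, h.2⟩⟩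

theorem sum_colourCount_le (φ : V → α) (v : V) (S : Finset α) :
    ∑ c ∈ S, colourCount G φ v c ≤ valency G v := by
  have := sum_colourCount_add (G := G) φ v S
  omega

/-- No colour of the list occurs less often around `v` than `φ v`, and three occurrences of each
would need 3k > Δ neighbours. -/
theorem IsOptimal.colourCount_le_two {L : V → Finset α} {φ : V → α} (h : IsOptimal G L φ) {v : V}
    {k Δ : ℕ} (hL : (L v).card = k) (hΔ : valency G v ≤ Δ) (hk : Δ + 2 ≤ 3 * k) :
    colourCount G φ v (φ v) ≤ 2 := by
  by_contra hcon
  have h1 := sum_colourCount_le (G := G) φ v (L v)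
  have h2 : (L v).card • 3 ≤ ∑ c ∈ L v, colourCount G φ v c :=
    Finset.card_nsmul_le_sum _ _ _ fun c hc => by
      have := h.colourCount_le hc
      omega
  rw [smul_eq_mul, hL] at h2
  omega

/-- Otherwise `v` would have at least 2 + 3(k - 1) = 3k - 1 > Δ neighbours. -/
theorem IsOptimal.exists_target {L : V → Finset α} {φ : V → α} (h : IsOptimal G L φ) {v : V}
    {k Δ : ℕ} (hL : (L v).card = k) (hΔ : valency G v ≤ Δ) (hk : Δ + 2 ≤ 3 * k)
    (hv : colourCount G φ v (φ v) = 2) :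
    ∃ c ∈ L v, c ≠ φ v ∧ colourCount G φ v c = 2 := by
  by_contra hcon
  push Not at hcon
  have h1 := sum_colourCount_le (G := G) φ v (L v)
  rw [← Finset.sum_erase_add _ _ (h.1 v), hv] at h1
  have h2 : ((L v).erase (φ v)).card • 3 ≤ ∑ c ∈ (L v).erase (φ v), colourCount G φ v c :=
    Finset.card_nsmul_le_sum _ _ _ fun c hc => by
      have h3 := h.colourCount_le (Finset.mem_of_mem_erase hc)
      have h4 := hcon c (Finset.mem_of_mem_erase hc) (Finset.ne_of_mem_erase hc)
      omega
  rw [smul_eq_mul, Finset.card_erase_of_mem (h.1 v), hL] at h2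
  omega

/-- `τ` assigns to every vertex with two neighbours of its own colour another colour from its list
which appears exactly twice in its neighbourhood. -/
def IsTarget (G : SimpleGraph V) (L : V → Finset α) (φ τ : V → α) : Prop :=
  ∀ v, colourCount G φ v (φ v) = 2 → τ v ∈ L v ∧ τ v ≠ φ v ∧ colourCount G φ v (τ v) = 2

theorem IsOptimal.exists_isTarget {L : V → Finset α} {φ : V → α} (h : IsOptimal G L φ)
    {k Δ : ℕ} (hL : ∀ v, (L v).card = k) (hΔ : ∀ v, valency G v ≤ Δ) (hk : Δ + 2 ≤ 3 * k) :
    ∃ τ, IsTarget G L φ τ := by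
  have : ∀ v, ∃ c, colourCount G φ v (φ v) = 2 → c ∈ L v ∧ c ≠ φ v ∧ colourCount G φ v c = 2 := by
    intro v
    by_cases hv : colourCount G φ v (φ v) = 2
    · obtain ⟨c, hc⟩ := h.exists_target (hL v) (hΔ v) hk hv
      exact ⟨c, fun _ => hc⟩
    · exact ⟨φ v, fun h => absurd h hv⟩
  choose τ hτ using this
  exact ⟨τ, hτ⟩

/-- The vertices of `Y` have two neighbours of their own colour and are pairwise non-adjacent. -/
def IsRecolourable (G : SimpleGraph V) (φ : V → α) (Y : Finset V) : Prop :=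
  (∀ y ∈ Y, colourCount G φ y (φ y) = 2) ∧ ∀ y ∈ Y, ∀ y' ∈ Y, ¬ G.Adj y y'

theorem IsRecolourable.mono {φ : V → α} {Y Y' : Finset V} (h : IsRecolourable G φ Y)
    (hY : Y' ⊆ Y) : IsRecolourable G φ Y' :=
  ⟨fun y hy => h.1 y (hY hy), fun y hy y' hy' => h.2 y (hY hy) y' (hY hy')⟩

/-- As `Y` is independent, its vertices can be recoloured one at a time without affecting the
colours around the others; each exchanges two monochromatic edges for two. -/
theorem energy_recolour {L : V → Finset α} {φ τ : V → α} (hτ : IsTarget G L φ τ) {Y : Finset V}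
    (hY : IsRecolourable G φ Y) : energy G (recolour φ τ Y) = energy G φ := by
  induction Y using Finset.induction_on with
  | empty => congr 1
  | insert a Y ha ih =>
    have hup : recolour φ τ (insert a Y) = Function.update (recolour φ τ Y) a (τ a) := by
      ext v
      by_cases hv : v = a
      · subst hv; simp [recolour]
      · rw [Function.update_of_ne hv]; simp [recolour, hv]
    have hcount : ∀ c, colourCount G (recolour φ τ Y) a c = colourCount G φ a c := by
      intro c
      unfold colourCount
      congr 1
      ext u
      simp only [Finset.mem_filter, Finset.mem_univ, true_and]
      refine and_congr_right fun h => ?_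
      have : u ∉ Y := fun hu =>
        hY.2 a (Finset.mem_insert_self _ _) u (Finset.mem_insert_of_mem hu) h
      simp [recolour, this]
    have h1 := energy_update (G := G) (recolour φ τ Y) a (τ a)
    have haY : recolour φ τ Y a = φ a := by simp [recolour, ha]
    have h2 := hY.1 a (Finset.mem_insert_self _ _)
    have h3 := (hτ a h2).2.2
    rw [haY, hcount, hcount, h2, h3, ih (hY.mono (Finset.subset_insert _ _))] at h1
    rw [hup]
    omega

/-- The main tool: every bound on colour counts derived from optimality also constrains the
recoloured graph. -/
theorem IsOptimal.recolour {L : V → Finset α} {φ τ : V → α} (h : IsOptimal G L φ)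
    (hτ : IsTarget G L φ τ) {Y : Finset V} (hY : IsRecolourable G φ Y) :
    IsOptimal G L (recolour φ τ Y) := by
  refine ⟨fun v => ?_, fun ψ hψ => ?_⟩
  · unfold ClusteredChoosability.recolour
    split_ifs with hv
    · exact (hτ v (hY.1 v hv)).1
    · exact h.1 v
  · rw [energy_recolour hτ hY]
    exact h.2 ψ hψ

/-- The neighbours that `y` gets in the monochromatic subgraph when it is recoloured. -/
def IsArm (G : SimpleGraph V) (φ τ : V → α) (y u : V) : Prop :=
  G.Adj y u ∧ φ u = τ y

/-- Recolouring `A` turns its members into neighbours of `u` of the same colour, while `u` keeps the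
old ones; optimality still allows only two. -/
theorem card_add_valency_le_two {L : V → Finset α} {φ τ : V → α} (h : IsOptimal G L φ)
    (hτ : IsTarget G L φ τ) {k Δ : ℕ} (hL : ∀ v, (L v).card = k) (hΔ : ∀ v, valency G v ≤ Δ)
    (hk : Δ + 2 ≤ 3 * k) {A : Finset V} (hA : IsRecolourable G φ A) {u : V}
    (hu : ∀ y ∈ A, IsArm G φ τ y u) :
    A.card + valency (monochromaticSubgraph G φ) u ≤ 2 := by
  have h1 := (h.recolour hτ hA).colourCount_le_two (hL u) (hΔ u) hk
  have huA : u ∉ A := fun hmem => G.irrefl (hu u hmem).1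
  have huφ : recolour φ τ A u = φ u := by simp [recolour, huA]
  rw [huφ] at h1
  rw [valency_monochromaticSubgraph]
  refine le_trans ?_ h1
  unfold colourCount
  rw [← Finset.card_union_of_disjoint]
  · apply Finset.card_le_card
    intro w hw
    simp only [Finset.mem_union, Finset.mem_filter, Finset.mem_univ, true_and] at hw ⊢
    rcases hw with hw | hw
    · refine ⟨(hu w hw).1.symm, ?_⟩
      simp [recolour, hw, (hu w hw).2]
    · refine ⟨hw.1, ?_⟩
      by_cases hwA : w ∈ A
      · exact absurd ((hu w hwA).2.symm.trans hw.2.symm) (hτ w (hA.1 w hwA)).2.1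
      · simpa [recolour, hwA] using hw.2
  · rw [Finset.disjoint_left]
    intro w hw hw'
    simp only [Finset.mem_filter, Finset.mem_univ, true_and] at hw'
    exact (hτ w (hA.1 w hw)).2.1 ((hu w hw).2.symm.trans hw'.2.symm)

/-- A vertex of a set `K` of recolourable vertices, no two of which are adjacent in the
monochromatic subgraph, has few neighbours in `K`. -/
theorem card_neighbours_le {L : V → Finset α} {φ τ : V → α} (h : IsOptimal G L φ)
    (hτ : IsTarget G L φ τ) {k Δ : ℕ} (hL : ∀ v, (L v).card = k) (hΔ : ∀ v, valency G v ≤ Δ)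
    {K : Finset V} (hK : ∀ v ∈ K, colourCount G φ v (φ v) = 2)
    (hK' : ∀ v ∈ K, ∀ w ∈ K, ¬ (monochromaticSubgraph G φ).Adj v w) {v : V} (hv : v ∈ K) :
    (Finset.univ.filter fun u => G.Adj v u ∧ u ∈ K).card ≤ Δ - 2 * k := by
  set U : α → Finset V := fun d => Finset.univ.filter fun u => (G.Adj v u ∧ u ∈ K) ∧ φ u = d with hU
  -- For d ≠ `φ v`, recolouring `U d` takes the colour d from these neighbours and leaves `v` with
  -- two of its own colour. By optimality d must still occur twice.
  have hUd : ∀ d ∈ L v, (U d).card + 2 ≤ colourCount G φ v d := by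
    intro d hd
    have hrec : IsRecolourable G φ (U d) := by
      refine ⟨fun y hy => hK y ?_, fun y hy y' hy' hadj => hK' y ?_ y' ?_ ⟨hadj, ?_⟩⟩ <;>
        simp only [hU, Finset.mem_filter, Finset.mem_univ, true_and] at *
      · exact hy.1.2
      · exact hy.1.2
      · exact hy'.1.2
      · rw [hy.2, hy'.2]
    have hvU : v ∉ U d := by simp [hU]
    have h1 := (h.recolour hτ hrec).colourCount_le (v := v) hd
    have hvφ : recolour φ τ (U d) v = φ v := by simp [recolour, hvU]
    rw [hvφ] at h1
    by_cases hdv : d = φ v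
    · have : U d = ∅ := by
        rw [Finset.eq_empty_iff_forall_notMem]
        intro u hu
        simp only [hU, Finset.mem_filter, Finset.mem_univ, true_and] at hu
        exact hK' v hv u hu.1.2 ⟨hu.1.1, (hu.2.trans hdv).symm⟩
      rw [this, hdv, hK v hv]
      simp
    · have h2 : 2 ≤ colourCount G (recolour φ τ (U d)) v (φ v) := by
        rw [← hK v hv]
        apply Finset.card_le_card
        intro u hu
        simp only [Finset.mem_filter, Finset.mem_univ, true_and] at hu ⊢
        refine ⟨hu.1, ?_⟩
        have : u ∉ U d := fun hmem => by
          simp only [hU, Finset.mem_filter] at hmem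
          exact hdv (hmem.2.2.symm.trans hu.2)
        simpa [recolour, this] using hu.2
      have h3 : (U d).card + colourCount G (recolour φ τ (U d)) v d ≤ colourCount G φ v d := by
        unfold colourCount
        rw [← Finset.card_union_of_disjoint]
        · apply Finset.card_le_card
          intro u hu
          simp only [Finset.mem_union, Finset.mem_filter, Finset.mem_univ, true_and] at hu ⊢
          by_cases hmem : u ∈ U d
          · simp only [hU, Finset.mem_filter] at hmem
            exact ⟨hmem.2.1.1, hmem.2.2⟩
          · have := hu.resolve_left hmem
            simpa [recolour, hmem] using this
        · rw [Finset.disjoint_left]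
          intro u hu hu'
          simp only [Finset.mem_filter, Finset.mem_univ, true_and] at hu'
          have hc : recolour φ τ (U d) u = τ u := by simp [recolour, hu]
          have hne := (hτ u (hrec.1 u hu)).2.1
          rw [← hc, hu'.2] at hne
          simp only [hU, Finset.mem_filter] at hu
          exact hne hu.2.2.symm
      omega
  have hsum : ∑ d ∈ L v, ((U d).card + 2) ≤ ∑ d ∈ L v, colourCount G φ v d :=
    Finset.sum_le_sum hUd
  rw [Finset.sum_add_distrib, Finset.sum_const, hL v, smul_eq_mul] at hsum
  have htot := sum_colourCount_add (G := G) φ v (L v)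
  -- Neighbours coloured outside `L v` are counted separately, so the k colours of the list account
  -- for the full loss of 2k.
  have hsplit : (Finset.univ.filter fun u => G.Adj v u ∧ u ∈ K).card ≤
      ∑ d ∈ L v, (U d).card + (Finset.univ.filter fun u => G.Adj v u ∧ φ u ∉ L v).card := by
    have hsub : (Finset.univ.filter fun u => G.Adj v u ∧ u ∈ K) ⊆
        (L v).biUnion U ∪ Finset.univ.filter fun u => G.Adj v u ∧ φ u ∉ L v := by
      intro u hu
      simp only [hU, Finset.mem_union, Finset.mem_biUnion, Finset.mem_filter, Finset.mem_univ,
        true_and] at hu ⊢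
      by_cases hmem : φ u ∈ L v
      · exact Or.inl ⟨_, hmem, hu, rfl⟩
      · exact Or.inr ⟨hu.1, hmem⟩
    refine (Finset.card_le_card hsub).trans ((Finset.card_union_le _ _).trans ?_)
    exact Nat.add_le_add_right Finset.card_biUnion_le _
  have := hΔ v
  omega

end Recolouring

/-! ### Arms and the link graph -/

section Links

variable {V α : Type*} [Fintype V] {G : SimpleGraph V}

/-- The vertex sets of the components of `H` in which all degrees are two. -/
noncomputable def cyclicComps (H : SimpleGraph V) : Finset (Finset V) :=
  Finset.univ.filter fun S => ∃ v, S = comp H v ∧ ∀ u ∈ S, valency H u = 2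

theorem comp_mem_cyclicComps {H : SimpleGraph V} {v : V} :
    comp H v ∈ cyclicComps H ↔ ∀ u, H.Reachable v u → valency H u = 2 := by
  simp only [cyclicComps, Finset.mem_filter, Finset.mem_univ, true_and, mem_comp]
  constructor
  · rintro ⟨w, -, h⟩
    exact h
  · exact fun h => ⟨v, rfl, h⟩

theorem exists_of_mem_cyclicComps {H : SimpleGraph V} {S : Finset V} (h : S ∈ cyclicComps H) :
    ∃ v, S = comp H v ∧ ∀ u, H.Reachable v u → valency H u = 2 := by
  simp only [cyclicComps, Finset.mem_filter, Finset.mem_univ, true_and] at h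
  obtain ⟨v, rfl, h⟩ := h
  exact ⟨v, rfl, fun u hu => h u (by simpa using hu)⟩

/-- An optimal colouring, with a target for each vertex of monochromatic degree two. -/
structure Setting (G : SimpleGraph V) (L : V → Finset α) (φ τ : V → α) (k Δ : ℕ) : Prop where
  opt : IsOptimal G L φ
  target : IsTarget G L φ τ
  card_list : ∀ v, (L v).card = k
  valency_le : ∀ v, valency G v ≤ Δ
  le_three_mul : Δ + 2 ≤ 3 * k

/-- The pairs `(y, u)` with `y` in `Y` and `u` an arm of `y` in the component of `v`. -/
noncomputable def incidences (G : SimpleGraph V) (φ τ : V → α) (Y : Finset V) (v : V) :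
    Finset (V × V) :=
  Finset.univ.filter fun p => p.1 ∈ Y ∧ IsArm G φ τ p.1 p.2 ∧
    (monochromaticSubgraph G φ).Reachable v p.2

/-- Two vertices of `Y` are linked if they have arms in the same component, of size at most `m`. -/
def linkGraph (G : SimpleGraph V) (φ τ : V → α) (Y : Finset V) (m : ℕ) : SimpleGraph V where
  Adj y y' := y ≠ y' ∧ y ∈ Y ∧ y' ∈ Y ∧ ∃ u u', IsArm G φ τ y u ∧ IsArm G φ τ y' u' ∧
    (monochromaticSubgraph G φ).Reachable u u' ∧
    (comp (monochromaticSubgraph G φ) u).card ≤ m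
  symm := ⟨by
    rintro y y' ⟨h1, h2, h3, u, u', h4, h5, h6, h7⟩
    exact ⟨h1.symm, h3, h2, u', u, h5, h4, h6.symm, by rwa [← comp_eq_of_reachable h6]⟩⟩
  loopless := ⟨fun _ h => h.1 rfl⟩

/-- A vertex at an inner position is adjacent to its predecessor and its successor. -/
theorem IsEnumeration.pos_of_valency_le_one {H : SimpleGraph V} {pos : V → ℕ}
    (hpos : IsEnumeration H pos) {u : V} (hu : valency H u ≤ 1) :
    pos u = 0 ∨ pos u + 1 = (comp H u).card := by
  by_contra hcon
  push Not at hcon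
  have hlt := hpos.lt u
  obtain ⟨a, ha, ha'⟩ := hpos.surj u (pos u - 1) (by omega)
  obtain ⟨b, hb, hb'⟩ := hpos.surj u (pos u + 1) (by omega)
  have h1 := hpos.adj_succ a u ha.symm (by omega)
  have h2 := hpos.adj_succ u b hb (by omega)
  have := two_le_valency h1.symm h2 (fun h => by subst h; omega)
  omega

theorem IsEnumeration.one_le_valency {H : SimpleGraph V} {pos : V → ℕ}
    (hpos : IsEnumeration H pos) {u : V} (hu : 2 ≤ (comp H u).card) : 1 ≤ valency H u := by
  have hlt := hpos.lt u
  have : ∃ w, H.Adj u w := by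
    by_cases h : pos u = 0
    · obtain ⟨b, hb, hb'⟩ := hpos.surj u 1 (by omega)
      exact ⟨b, hpos.adj_succ u b hb (by omega)⟩
    · obtain ⟨a, ha, ha'⟩ := hpos.surj u (pos u - 1) (by omega)
      exact ⟨a, (hpos.adj_succ a u ha.symm (by omega)).symm⟩
  obtain ⟨w, hw⟩ := this
  exact Finset.card_pos.2 ⟨w, by simpa using hw⟩

/-- At most two vertices of a component with at least two vertices have degree at most one. -/
theorem IsEnumeration.eq_or_eq_of_valency_le_one {H : SimpleGraph V} {pos : V → ℕ}
    (hpos : IsEnumeration H pos) {u v w : V} (huv : H.Reachable u v) (huw : H.Reachable u w)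
    (hu : valency H u ≤ 1) (hv : valency H v ≤ 1) (hw : valency H w ≤ 1) (hne : u ≠ v) :
    w = u ∨ w = v := by
  have h1 := hpos.pos_of_valency_le_one hu
  have h2 := hpos.pos_of_valency_le_one hv
  have h3 := hpos.pos_of_valency_le_one hw
  rw [← comp_eq_of_reachable huv] at h2
  rw [← comp_eq_of_reachable huw] at h3
  have h4 : pos u ≠ pos v := fun h => hne (hpos.inj u v huv h)
  have : pos w = pos u ∨ pos w = pos v := by omega
  rcases this with h | h
  · exact Or.inl (hpos.inj w u huw.symm h)
  · exact Or.inr (hpos.inj w v (huw.symm.trans huv) h)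

variable {L : V → Finset α} {φ τ : V → α} {k Δ : ℕ}

theorem Setting.valency_le_two (hs : Setting G L φ τ k Δ) (v : V) :
    valency (monochromaticSubgraph G φ) v ≤ 2 := by
  rw [valency_monochromaticSubgraph]
  exact hs.opt.colourCount_le_two (hs.card_list v) (hs.valency_le v) hs.le_three_mul

theorem Setting.valency_recolour_le_two (hs : Setting G L φ τ k Δ) {Y : Finset V}
    (hY : IsRecolourable G φ Y) (v : V) :
    valency (monochromaticSubgraph G (recolour φ τ Y)) v ≤ 2 := by
  rw [valency_monochromaticSubgraph]
  exact (hs.opt.recolour hs.target hY).colourCount_le_two (hs.card_list v) (hs.valency_le v)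
    hs.le_three_mul

theorem Setting.card_attached (hs : Setting G L φ τ k Δ) {Y : Finset V}
    (hY : IsRecolourable G φ Y) (u : V) :
    (Y.filter fun y => IsArm G φ τ y u).card + valency (monochromaticSubgraph G φ) u ≤ 2 :=
  card_add_valency_le_two hs.opt hs.target hs.card_list hs.valency_le hs.le_three_mul
    (hY.mono (Finset.filter_subset _ _)) fun _ hy => (Finset.mem_filter.1 hy).2

/-- Recolouring `y` gives `u` one more neighbour of its colour, and two is the limit. -/
theorem Setting.valency_arm_le_one (hs : Setting G L φ τ k Δ) {Y : Finset V}
    (hY : IsRecolourable G φ Y) {y u : V} (hy : y ∈ Y) (hu : IsArm G φ τ y u) :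
    valency (monochromaticSubgraph G φ) u ≤ 1 := by
  have h1 := hs.card_attached hY u
  have h2 : 0 < (Y.filter fun y => IsArm G φ τ y u).card :=
    Finset.card_pos.2 ⟨y, Finset.mem_filter.2 ⟨hy, hu⟩⟩
  omega

theorem Setting.card_arms (hs : Setting G L φ τ k Δ) {Y : Finset V}
    (hY : IsRecolourable G φ Y) {y : V} (hy : y ∈ Y) :
    (Finset.univ.filter fun u => IsArm G φ τ y u).card = 2 := by
  rw [← (hs.target y (hY.1 y hy)).2.2, colourCount]
  congr 1
  ext u
  simp only [Finset.mem_filter, Finset.mem_univ, true_and]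
  rfl

theorem mem_incidences {Y : Finset V} {v : V} {p : V × V} :
    p ∈ incidences G φ τ Y v ↔ p.1 ∈ Y ∧ IsArm G φ τ p.1 p.2 ∧
      (monochromaticSubgraph G φ).Reachable v p.2 := by
  simp [incidences]

/-- In a component with at least two vertices, `u` has a neighbour of its colour already, which
leaves room for one recoloured vertex. -/
theorem Setting.eq_of_arm_of_arm (hs : Setting G L φ τ k Δ) {Y : Finset V}
    (hY : IsRecolourable G φ Y) {pos : V → ℕ}
    (hpos : IsEnumeration (monochromaticSubgraph G φ) pos) {y y' u : V} (hy : y ∈ Y) (hy' : y' ∈ Y)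
    (hu : IsArm G φ τ y u) (hu' : IsArm G φ τ y' u)
    (hcard : 2 ≤ (comp (monochromaticSubgraph G φ) u).card) : y = y' := by
  by_contra hne
  have h1 := hs.card_attached hY u
  have h2 := hpos.one_le_valency hcard
  have h3 : ({y, y'} : Finset V) ⊆ Y.filter fun y => IsArm G φ τ y u := by
    intro x hx
    simp only [Finset.mem_insert, Finset.mem_singleton] at hx
    rcases hx with rfl | rfl <;> simp [*]
  have h4 := Finset.card_le_card h3
  rw [Finset.card_pair hne] at h4
  omega

/-- An isolated vertex can be an arm of two vertices. In a larger component only the two ends can be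
arms, each of one vertex. This bounds the degrees of the link graph. -/
theorem Setting.card_incidences_le (hs : Setting G L φ τ k Δ) {Y : Finset V}
    (hY : IsRecolourable G φ Y) (v : V) : (incidences G φ τ Y v).card ≤ 2 := by
  obtain ⟨pos, hpos⟩ := exists_enumeration hs.valency_le_two
  by_cases hcard : (comp (monochromaticSubgraph G φ) v).card ≤ 1
  · have hv : ∀ u, (monochromaticSubgraph G φ).Reachable v u → u = v := fun u hu =>
      Finset.card_le_one.1 hcard u (by simpa using hu) v (by simp)
    have h1 := hs.card_attached hY v
    refine le_trans ?_ (le_trans (Nat.le_add_right _ _) h1)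
    refine Finset.card_le_card_of_injOn Prod.fst ?_ ?_
    · intro p hp
      have hp' := mem_incidences.1 hp
      rw [hv _ hp'.2.2] at hp'
      exact Finset.mem_coe.2 (Finset.mem_filter.2 ⟨hp'.1, hp'.2.1⟩)
    · intro p hp q hq h
      have hp' := mem_incidences.1 hp
      have hq' := mem_incidences.1 hq
      exact Prod.ext h ((hv _ hp'.2.2).trans (hv _ hq'.2.2).symm)
  · by_contra hcon
    push Not at hcard hcon
    obtain ⟨p, hp, q, hq, r, hr, hpq, hpr, hqr⟩ := Finset.two_lt_card_iff.1 hcon |>.elim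
      fun a h => h.elim fun b h => h.elim fun c h =>
        (⟨a, h.1, b, h.2.1, c, h.2.2.1, h.2.2.2.1, h.2.2.2.2.1, h.2.2.2.2.2⟩ :
          ∃ p ∈ incidences G φ τ Y v, ∃ q ∈ incidences G φ τ Y v, ∃ r ∈ incidences G φ τ Y v,
            p ≠ q ∧ p ≠ r ∧ q ≠ r)
    have aux : ∀ p ∈ incidences G φ τ Y v, ∀ q ∈ incidences G φ τ Y v, p ≠ q → p.2 ≠ q.2 := by
      intro p hp q hq hpq h
      have hp' := mem_incidences.1 hp
      have hq' := mem_incidences.1 hq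
      rw [← h] at hq'
      refine hpq (Prod.ext ?_ h)
      exact hs.eq_of_arm_of_arm hY hpos hp'.1 hq'.1 hp'.2.1 hq'.2.1
        (by rw [← comp_eq_of_reachable hp'.2.2]; omega)
    have hp' := mem_incidences.1 hp
    have hq' := mem_incidences.1 hq
    have hr' := mem_incidences.1 hr
    rcases hpos.eq_or_eq_of_valency_le_one (hp'.2.2.symm.trans hq'.2.2)
      (hp'.2.2.symm.trans hr'.2.2) (hs.valency_arm_le_one hY hp'.1 hp'.2.1)
      (hs.valency_arm_le_one hY hq'.1 hq'.2.1) (hs.valency_arm_le_one hY hr'.1 hr'.2.1)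
      (aux p hp q hq hpq) with h | h
    · exact aux r hr p hp hpr.symm h
    · exact aux r hr q hq hqr.symm h

/-- The neighbours of `y` in the link graph are found among the other incidences of those
components of arms which are small and not used by `y` alone. -/
theorem Setting.valency_linkGraph_le (hs : Setting G L φ τ k Δ) {Y : Finset V}
    (hY : IsRecolourable G φ Y) (m : ℕ) (y : V) :
    valency (linkGraph G φ τ Y m) y ≤ (Finset.univ.filter fun u => IsArm G φ τ y u ∧
      ∃ y' u', (linkGraph G φ τ Y m).Adj y y' ∧ IsArm G φ τ y' u' ∧
        (monochromaticSubgraph G φ).Reachable u u' ∧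
        (comp (monochromaticSubgraph G φ) u).card ≤ m).card := by
  by_cases hy : y ∈ Y
  · set B := Finset.univ.filter fun u => IsArm G φ τ y u ∧
      ∃ y' u', (linkGraph G φ τ Y m).Adj y y' ∧ IsArm G φ τ y' u' ∧
        (monochromaticSubgraph G φ).Reachable u u' ∧
        (comp (monochromaticSubgraph G φ) u).card ≤ m with hB
    have hsub : (Finset.univ.filter fun y' => (linkGraph G φ τ Y m).Adj y y') ⊆
        B.biUnion fun u => ((incidences G φ τ Y u).erase (y, u)).image Prod.fst := by
      intro y' hy'
      simp only [Finset.mem_filter, Finset.mem_univ, true_and] at hy'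
      have hadj := hy'
      obtain ⟨hne, -, hyY', u, u', hu, hu', hr, hc⟩ := hy'
      simp only [Finset.mem_biUnion, Finset.mem_image, Finset.mem_erase, mem_incidences]
      refine ⟨u, ?_, (y', u'), ⟨fun h => hne (congrArg Prod.fst h).symm, hyY', hu', hr⟩, rfl⟩
      rw [hB, Finset.mem_filter]
      exact ⟨Finset.mem_univ _, hu, y', u', hadj, hu', hr, hc⟩
    refine (Finset.card_le_card hsub).trans ?_
    -- Besides `(y, u)` there is at most one incidence in the component of `u`, so every arm yields
    -- at most one link.
    rw [← mul_one B.card]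
    refine Finset.card_biUnion_le_card_mul _ _ _ fun u hu => Finset.card_image_le.trans ?_
    have hmem : (y, u) ∈ incidences G φ τ Y u :=
      mem_incidences.2 ⟨hy, (Finset.mem_filter.1 hu).2.1, .refl _⟩
    rw [Finset.card_erase_of_mem hmem]
    have := hs.card_incidences_le hY u
    omega
  · have : valency (linkGraph G φ τ Y m) y = 0 := by
      rw [valency, Finset.card_eq_zero, Finset.filter_eq_empty_iff]
      exact fun u _ h => hy h.2.1
    omega

theorem Setting.valency_linkGraph_le_two (hs : Setting G L φ τ k Δ) {Y : Finset V}
    (hY : IsRecolourable G φ Y) (m : ℕ) (y : V) : valency (linkGraph G φ τ Y m) y ≤ 2 := by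
  by_cases hy : y ∈ Y
  · refine (hs.valency_linkGraph_le hY m y).trans ?_
    rw [← hs.card_arms hY hy]
    refine Finset.card_le_card fun u hu => ?_
    simp only [Finset.mem_filter, Finset.mem_univ, true_and] at hu ⊢
    exact hu.1
  · have : valency (linkGraph G φ τ Y m) y = 0 := by
      rw [valency, Finset.card_eq_zero, Finset.filter_eq_empty_iff]
      exact fun u _ h => hy h.2.1
    omega

/-- Each of the two arms yields at most one link, so a vertex with two links has one at each arm. -/
theorem Setting.exists_link_of_arm (hs : Setting G L φ τ k Δ) {Y : Finset V}
    (hY : IsRecolourable G φ Y) {m : ℕ} {y u : V} (hy : valency (linkGraph G φ τ Y m) y = 2)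
    (hu : IsArm G φ τ y u) :
    ∃ y' u', (linkGraph G φ τ Y m).Adj y y' ∧ IsArm G φ τ y' u' ∧
        (monochromaticSubgraph G φ).Reachable u u' ∧
        (comp (monochromaticSubgraph G φ) u).card ≤ m := by
  have hyY : y ∈ Y := by
    have : 0 < valency (linkGraph G φ τ Y m) y := by omega
    obtain ⟨x, hx⟩ := Finset.card_pos.1 this
    exact (Finset.mem_filter.1 hx).2.2.1
  by_contra hcon
  have h1 := hs.valency_linkGraph_le hY m y
  have h2 := hs.card_arms hY hyY
  have h3 := Finset.card_lt_card (s := Finset.univ.filter fun u => IsArm G φ τ y u ∧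
      ∃ y' u', (linkGraph G φ τ Y m).Adj y y' ∧ IsArm G φ τ y' u' ∧
        (monochromaticSubgraph G φ).Reachable u u' ∧
        (comp (monochromaticSubgraph G φ) u).card ≤ m)
    (t := Finset.univ.filter fun u => IsArm G φ τ y u) (by
      rw [Finset.ssubset_iff_of_subset]
      · refine ⟨u, by simpa using hu, fun h => ?_⟩
        exact hcon (Finset.mem_filter.1 h).2.2
      · intro w hw
        simp only [Finset.mem_filter, Finset.mem_univ, true_and] at hw ⊢
        exact hw.1)
  omega

end Links

/-! ### Link cycles and maximality of the number of cyclic components -/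

section CyclicLinks

variable {V α : Type*} [Fintype V] {G : SimpleGraph V} {L : V → Finset α} {φ τ : V → α} {k Δ : ℕ}

local notation "𝓜" => monochromaticSubgraph G φ

/-- The vertices of `Z` together with the components of their arms. -/
def linkSpan (G : SimpleGraph V) (φ τ : V → α) (Z : Finset V) : Set V :=
  {w | w ∈ Z ∨ ∃ y ∈ Z, ∃ u, IsArm G φ τ y u ∧ (monochromaticSubgraph G φ).Reachable u w}

/-- Recolouring all vertices of a cyclic component `Z` of the link graph turns the span of `Z` into
a closed set of vertices of degree two. -/
theorem Setting.linkSpan_closed (hs : Setting G L φ τ k Δ) {Y : Finset V}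
    (hY : IsRecolourable G φ Y) {m : ℕ}
    (hlarge : ∀ y ∈ Y, m < (comp 𝓜 y).card) {Y' : Finset V}
    (hY' : Y' ⊆ Y) {z : V}
    (hz : ∀ u, (linkGraph G φ τ Y m).Reachable z u → valency (linkGraph G φ τ Y m) u = 2)
    (hzY' : comp (linkGraph G φ τ Y m) z ⊆ Y') :
    ∀ w ∈ linkSpan G φ τ (comp (linkGraph G φ τ Y m) z),
      valency (monochromaticSubgraph G (recolour φ τ Y')) w = 2 ∧
      ∀ x, (monochromaticSubgraph G (recolour φ τ Y')).Adj w x →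
        x ∈ linkSpan G φ τ (comp (linkGraph G φ τ Y m) z) := by
  set Z := comp (linkGraph G φ τ Y m) z with hZ
  have hrec' := hY.mono hY'
  have hle := hs.valency_recolour_le_two hrec'
  have hin : ∀ w ∈ Y', recolour φ τ Y' w = τ w := fun w hw => by simp [recolour, hw]
  have hout : ∀ w, w ∉ Y' → recolour φ τ Y' w = φ w := fun w hw => by simp [recolour, hw]
  rintro w (hw | ⟨y, hy, u, hu, huw⟩)
  · have hwY' := hzY' hw
    have hnot : ∀ x, G.Adj w x → x ∉ Y' := fun x hx hx' => hrec'.2 w hwY' x hx' hx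
    constructor
    · rw [valency_monochromaticSubgraph, hin w hwY', ← hs.card_arms hrec' hwY', colourCount]
      congr 1
      ext x
      simp only [Finset.mem_filter, Finset.mem_univ, true_and]
      exact and_congr_right fun hx => by rw [hout x (hnot x hx)]
    · rintro x ⟨hx, hx'⟩
      rw [hin w hwY', hout x (hnot x hx)] at hx'
      exact Or.inr ⟨w, hw, x, ⟨hx, hx'.symm⟩, .refl _⟩
  · have hyY' := hzY' hy
    obtain ⟨y', u', hyy', hu', huu', hsmall⟩ :=
      hs.exists_link_of_arm hY (hz y (by simpa [hZ] using hy)) hu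
    have hy' : y' ∈ Z := by
      have : (linkGraph G φ τ Y m).Reachable z y := by simpa [hZ] using hy
      simpa [hZ] using this.trans hyy'.reachable
    have hy'Y' := hzY' hy'
    -- The component carrying a link is too small to contain vertices of `Y`, so recolouring leaves
    -- it intact.
    have hnotY : ∀ x, (𝓜).Reachable u x → x ∉ Y := by
      intro x hx hxY
      have := hlarge x hxY
      rw [← comp_eq_of_reachable hx] at this
      omega
    have hwφ := hout w fun h => hnotY w huw (hY' h)
    have hinc : incidences G φ τ Y u = {(y, u), (y', u')} := by
      symm
      apply Finset.eq_of_subset_of_card_le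
      · intro p hp
        simp only [Finset.mem_insert, Finset.mem_singleton] at hp
        rcases hp with rfl | rfl
        · exact mem_incidences.2 ⟨hY' hyY', hu, .refl _⟩
        · exact mem_incidences.2 ⟨hY' hy'Y', hu', huu'⟩
      · rw [Finset.card_pair fun h => hyy'.1 (congrArg Prod.fst h)]
        exact hs.card_incidences_le hY u
    constructor
    · refine le_antisymm (hle w) ?_
      have hold : ∀ x, (𝓜).Adj w x → (monochromaticSubgraph G (recolour φ τ Y')).Adj w x := by
        intro x hx
        refine ⟨hx.1, ?_⟩
        rw [hwφ, hout x fun h => hnotY x (huw.trans hx.reachable) (hY' h)]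
        exact hx.2
      have hnew : ∀ x ∈ Y', IsArm G φ τ x w →
          (monochromaticSubgraph G (recolour φ τ Y')).Adj w x := by
        intro x hx hxw
        exact ⟨hxw.1.symm, by rw [hwφ, hin x hx, hxw.2]⟩
      have hnewold : ∀ x ∈ Y', ∀ x', (𝓜).Adj w x' → x ≠ x' := by
        rintro x hx x' hx' rfl
        exact hnotY x (huw.trans hx'.reachable) (hY' hx)
      obtain ⟨pos, hpos⟩ := exists_enumeration hs.valency_le_two
      -- A single vertex receives both y and y'. In a larger path the inner vertices have degree two
      -- already, and each end receives one of y and y'.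
      by_cases hcard : (comp 𝓜 u).card ≤ 1
      · have h1 : ∀ x, (𝓜).Reachable u x → x = u := fun x hx =>
          Finset.card_le_one.1 hcard x (by simpa using hx) u (by simp)
        have e1 := h1 w huw
        have e2 := h1 u' huu'
        subst e1 e2
        exact two_le_valency (hnew y hyY' hu) (hnew y' hy'Y' hu') hyy'.1
      · by_cases hval : 2 ≤ valency 𝓜 w
        · refine hval.trans (Finset.card_le_card fun x hx => ?_)
          simp only [Finset.mem_filter, Finset.mem_univ, true_and] at hx ⊢
          exact hold x hx
        · have hne : u ≠ u' := by
            rintro rfl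
            exact hyy'.1 (hs.eq_of_arm_of_arm hY hpos (hY' hyY') (hY' hy'Y') hu hu' (by omega))
          have h1 := hpos.one_le_valency (u := w) (by rw [← comp_eq_of_reachable huw]; omega)
          obtain ⟨x, hx⟩ := Finset.card_pos.1 h1
          have hx' : (𝓜).Adj w x := by simpa using hx
          rcases hpos.eq_or_eq_of_valency_le_one huu' huw (hs.valency_arm_le_one hrec' hyY' hu)
            (hs.valency_arm_le_one hrec' hy'Y' hu') (by omega) hne with h | h
          · exact two_le_valency (hold x hx') (hnew y hyY' (by rwa [h])) (hnewold y hyY' x hx').symm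
          · exact two_le_valency (hold x hx') (hnew y' hy'Y' (by rwa [h]))
              (hnewold y' hy'Y' x hx').symm
    · rintro x ⟨hx, hx'⟩
      rw [hwφ] at hx'
      by_cases hxY : x ∈ Y'
      · rw [hin x hxY] at hx'
        have hmem : (x, w) ∈ incidences G φ τ Y u :=
          mem_incidences.2 ⟨hY' hxY, ⟨hx.symm, hx'⟩, huw⟩
        rw [hinc] at hmem
        simp only [Finset.mem_insert, Finset.mem_singleton, Prod.mk.injEq] at hmem
        rcases hmem with ⟨rfl, -⟩ | ⟨rfl, -⟩
        · exact Or.inl hy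
        · exact Or.inl hy'
      · rw [hout x hxY] at hx'
        have : (𝓜).Adj w x := ⟨hx, hx'⟩
        exact Or.inr ⟨y, hy, u, hu, huw.trans this.reachable⟩

/-- A cyclic monochromatic component none of whose vertices is recoloured stays one. -/
theorem Setting.comp_recolour_of_disjoint (hs : Setting G L φ τ k Δ) {Y : Finset V}
    (hY : IsRecolourable G φ Y) {P : Finset V} (hP : P ∈ cyclicComps 𝓜)
    (hd : Disjoint P Y) : P ∈ cyclicComps (monochromaticSubgraph G (recolour φ τ Y)) := by
  obtain ⟨v, rfl, hv⟩ := exists_of_mem_cyclicComps hP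
  set F' := monochromaticSubgraph G (recolour φ τ Y) with hF'
  have hnot : ∀ x, (𝓜).Reachable v x → x ∉ Y := fun x hx hxY =>
    Finset.disjoint_left.1 hd (by simpa using hx) hxY
  have hin : ∀ w ∈ Y, recolour φ τ Y w = τ w := fun w hw => by simp [recolour, hw]
  have hout : ∀ w, w ∉ Y → recolour φ τ Y w = φ w := fun w hw => by simp [recolour, hw]
  have hold : ∀ w, (𝓜).Reachable v w → ∀ x, (𝓜).Adj w x → F'.Adj w x := by
    intro w hw x hx
    refine ⟨hx.1, ?_⟩
    rw [hout w (hnot w hw), hout x (hnot x (hw.trans hx.reachable))]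
    exact hx.2
  -- No recoloured vertex gets attached to a cyclic component, since arms have degree at most one.
  have hback : ∀ w, (𝓜).Reachable v w → ∀ x, F'.Adj w x → (𝓜).Adj w x := by
    rintro w hw x ⟨hx, hx'⟩
    rw [hout w (hnot w hw)] at hx'
    by_cases hxY : x ∈ Y
    · rw [hin x hxY] at hx'
      have h1 := hs.valency_arm_le_one hY hxY (u := w) ⟨hx.symm, hx'⟩
      have h2 := hv w hw
      omega
    · rw [hout x hxY] at hx'
      exact ⟨hx, hx'⟩
  have heq : comp 𝓜 v = comp F' v := by
    ext w
    simp only [mem_comp]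
    constructor
    · intro h
      have := mem_of_reachable_of_closed (H := 𝓜) (S := {x | (𝓜).Reachable v x ∧ F'.Reachable v x})
        (v := v) (w := w) (fun x hx y hxy =>
          ⟨hx.1.trans hxy.reachable, hx.2.trans (hold x hx.1 y hxy).reachable⟩)
        ⟨.refl _, .refl _⟩ h
      exact this.2
    · intro h
      exact mem_of_reachable_of_closed (H := F') (S := {x | (𝓜).Reachable v x})
        (v := v) (w := w) (fun x hx y hxy => hx.trans (hback x hx y hxy).reachable) (.refl _) h
  rw [heq, comp_mem_cyclicComps]
  intro u hu
  have hu' : (𝓜).Reachable v u := by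
    have : u ∈ comp F' v := by simpa using hu
    rw [← heq] at this
    simpa using this
  refine le_antisymm (hs.valency_recolour_le_two hY u) ?_
  rw [← hv u hu']
  refine Finset.card_le_card fun x hx => ?_
  simp only [Finset.mem_filter, Finset.mem_univ, true_and] at hx ⊢
  exact hold u hu' x hx

/-- If no recolouring increases the number of cyclic components, then the cyclic components of the
link graph have distinct representatives among the cyclic components that they meet. -/
theorem Setting.exists_cyclic_representatives (hs : Setting G L φ τ k Δ) {Y : Finset V}
    (hY : IsRecolourable G φ Y) {m : ℕ}
    (hlarge : ∀ y ∈ Y, m < (comp 𝓜 y).card)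
    (hmax : ∀ Y' ⊆ Y, (cyclicComps (monochromaticSubgraph G (recolour φ τ Y'))).card ≤
      (cyclicComps 𝓜).card) :
    ∃ R ⊆ Y, (∀ Z ∈ cyclicComps (linkGraph G φ τ Y m), ∃ r ∈ R, r ∈ Z) ∧
      (∀ r ∈ R, comp 𝓜 r ∈ cyclicComps 𝓜) ∧
      ∀ r ∈ R, ∀ r' ∈ R, (𝓜).Reachable r r' → r = r' := by
  set M := linkGraph G φ τ Y m with hM
  have hZY : ∀ Z ∈ cyclicComps M, Z ⊆ Y := by
    intro Z hZ y hy
    obtain ⟨v, rfl, hv⟩ := exists_of_mem_cyclicComps hZ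
    have h2 := hv y (by simpa using hy)
    have : 0 < valency M y := by omega
    obtain ⟨x, hx⟩ := Finset.card_pos.1 this
    exact (Finset.mem_filter.1 hx).2.2.1
  let t : {Z // Z ∈ cyclicComps M} → Finset (Finset V) := fun Z =>
    (cyclicComps 𝓜).filter fun P => ¬ Disjoint P Z.1
  -- Recolour the union `Y'` of the link cycles in `s`. Each gives a new cyclic component, and old
  -- ones disjoint from `Y'` survive. By maximality at least |s| old ones must meet `Y'`, which is
  -- Hall's condition.
  have hall : ∀ s : Finset {Z // Z ∈ cyclicComps M}, s.card ≤ (s.biUnion t).card := by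
    intro s
    set Y' := s.biUnion fun Z => Z.1 with hY'
    have hY'Y : Y' ⊆ Y := Finset.biUnion_subset.2 fun Z _ => hZY Z.1 Z.2
    have hrec := hY.mono hY'Y
    set F' := monochromaticSubgraph G (recolour φ τ Y') with hF'
    have hbu : s.biUnion t = (cyclicComps 𝓜).filter fun P => ¬ Disjoint P Y' := by
      ext P
      simp only [t, hY', Finset.mem_biUnion, Finset.mem_filter, Finset.disjoint_biUnion_right,
        not_forall]
      constructor
      · rintro ⟨Z, hZ, hP, hd⟩
        exact ⟨hP, Z, hZ, hd⟩
      · rintro ⟨hP, Z, hZ, hd⟩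
        exact ⟨Z, hZ, hP, hd⟩
    have hrep : ∀ Z : {Z // Z ∈ cyclicComps M}, ∃ z, Z.1 = comp M z ∧
        ∀ u, M.Reachable z u → valency M u = 2 := fun Z => exists_of_mem_cyclicComps Z.2
    choose z hz hzv using hrep
    have hsub : ∀ Z ∈ s, comp M (z Z) ⊆ Y' := by
      intro Z hZ
      rw [← hz Z]
      exact Finset.subset_biUnion_of_mem (fun Z : {Z // Z ∈ cyclicComps M} => Z.1) hZ
    have hspan : ∀ Z ∈ s, ∀ w, F'.Reachable (z Z) w → w ∈ linkSpan G φ τ (comp M (z Z)) := by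
      intro Z hZ w hw
      exact mem_of_reachable_of_closed (H := F')
        (fun u hu x hux => (hs.linkSpan_closed hY hlarge hY'Y (hzv Z) (hsub Z hZ) u hu).2 x hux)
        (Or.inl (by simp)) hw
    have hcyc : ∀ Z ∈ s, comp F' (z Z) ∈ cyclicComps F' := by
      intro Z hZ
      rw [comp_mem_cyclicComps]
      intro u hu
      exact (hs.linkSpan_closed hY hlarge hY'Y (hzv Z) (hsub Z hZ) u (hspan Z hZ u hu)).1
    -- The span of a link cycle contains no vertices of `Y` but its own, as the components of its
    -- arms are small. So the new cyclic components are distinct.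
    have hinj : ∀ Z ∈ s, ∀ Z' ∈ s, comp F' (z Z) = comp F' (z Z') → Z = Z' := by
      intro Z hZ Z' hZ' h
      have hz' : z Z' ∈ Y := hY'Y (hsub Z' hZ' (by simp))
      have h1 := hspan Z hZ (z Z') (reachable_iff_comp_eq.2 h)
      have h2 : z Z' ∈ comp M (z Z) := by
        rcases h1 with h1 | ⟨y, hy, u, hu, hr⟩
        · exact h1
        · exfalso
          obtain ⟨y', u', -, -, -, hsmall⟩ :=
            hs.exists_link_of_arm hY (hzv Z y (by simpa using hy)) hu
          have := hlarge _ hz'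
          rw [← comp_eq_of_reachable hr] at this
          omega
      apply Subtype.ext
      rw [hz Z, hz Z']
      exact comp_eq_of_reachable (by simpa using h2)
    have hcount : s.card + ((cyclicComps 𝓜).filter fun P => Disjoint P Y').card ≤
        (cyclicComps F').card := by
      rw [← Finset.card_image_of_injOn (s := s) (f := fun Z => comp F' (z Z))
        (fun Z hZ Z' hZ' h => hinj Z hZ Z' hZ' h), ← Finset.card_union_of_disjoint]
      · apply Finset.card_le_card
        intro P hP
        rcases Finset.mem_union.1 hP with hP | hP
        · obtain ⟨Z, hZ, rfl⟩ := Finset.mem_image.1 hP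
          exact hcyc Z hZ
        · obtain ⟨hP1, hP2⟩ := Finset.mem_filter.1 hP
          exact hs.comp_recolour_of_disjoint hrec hP1 hP2
      · rw [Finset.disjoint_left]
        intro P hP hP'
        obtain ⟨Z, hZ, rfl⟩ := Finset.mem_image.1 hP
        exact Finset.disjoint_left.1 (Finset.mem_filter.1 hP').2 (by simp : z Z ∈ _)
          (hsub Z hZ (by simp))
    have hm := hmax Y' hY'Y
    rw [← hF'] at hm
    have hsplit := Finset.card_filter_add_card_filter_not (s := cyclicComps 𝓜)
      (fun P => Disjoint P Y')
    rw [hbu]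
    omega
  obtain ⟨f, hf, hft⟩ := (Finset.all_card_le_biUnion_card_iff_exists_injective t).1 hall
  have hch : ∀ Z : {Z // Z ∈ cyclicComps M}, ∃ r, r ∈ f Z ∧ r ∈ Z.1 := fun Z => by
    have := (Finset.mem_filter.1 (hft Z)).2
    exact Finset.not_disjoint_iff.1 this
  choose r hr1 hr2 using hch
  have hcomp : ∀ Z, f Z = comp 𝓜 (r Z) := by
    intro Z
    obtain ⟨v, hv, -⟩ := exists_of_mem_cyclicComps (Finset.mem_filter.1 (hft Z)).1
    have := hr1 Z
    rw [hv] at this ⊢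
    exact comp_eq_of_reachable (by simpa using this)
  refine ⟨Finset.univ.image r, ?_, ?_, ?_, ?_⟩
  · intro x hx
    obtain ⟨Z, -, rfl⟩ := Finset.mem_image.1 hx
    exact hZY Z.1 Z.2 (hr2 Z)
  · intro Z hZ
    exact ⟨r ⟨Z, hZ⟩, Finset.mem_image_of_mem _ (Finset.mem_univ _), hr2 ⟨Z, hZ⟩⟩
  · intro x hx
    obtain ⟨Z, -, rfl⟩ := Finset.mem_image.1 hx
    rw [← hcomp]
    exact (Finset.mem_filter.1 (hft Z)).1
  · intro x hx x' hx' h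
    obtain ⟨Z, -, rfl⟩ := Finset.mem_image.1 hx
    obtain ⟨Z', -, rfl⟩ := Finset.mem_image.1 hx'
    have : f Z = f Z' := by rw [hcomp, hcomp]; exact comp_eq_of_reachable h
    rw [hf this]

end CyclicLinks

/-! ### Blocks, candidates and the pairing of blocks -/

section Halves

variable {V α : Type*} [Fintype V]

/-- The number of blocks of length `2 * s` into which the positions in the component of `v`, apart
from the last one, are divided. -/
noncomputable def blocks (F : SimpleGraph V) (s : ℕ) (v : V) : ℕ :=
  ((comp F v).card - 1) / (2 * s)

theorem blocks_eq_of_reachable {F : SimpleGraph V} {s : ℕ} {u v : V} (h : F.Reachable u v) :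
    blocks F s u = blocks F s v := by
  rw [blocks, blocks, comp_eq_of_reachable h]

theorem two_le_blocks {F : SimpleGraph V} {s : ℕ} (hs : 1 ≤ s) {v : V}
    (hv : 4 * s < (comp F v).card) : 2 ≤ blocks F s v := by
  rw [blocks, Nat.le_div_iff_mul_le (by omega)]
  omega

theorem blocks_mul_le {F : SimpleGraph V} {s : ℕ} {v : V} :
    2 * s * blocks F s v ≤ (comp F v).card - 1 := Nat.mul_div_le _ _

theorem card_le_blocks {F : SimpleGraph V} {s : ℕ} (hs : 1 ≤ s) (v : V) :
    (comp F v).card ≤ 2 * s * blocks F s v + 2 * s := by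
  have := Nat.lt_mul_div_succ ((comp F v).card - 1) (show 0 < 2 * s by omega)
  rw [mul_add, mul_one] at this
  unfold blocks
  omega

/-- The vertices at odd positions in the blocks of the components with more than `4 * s` vertices.
-/
noncomputable def candidates (F : SimpleGraph V) (pos : V → ℕ) (s : ℕ) : Finset V :=
  Finset.univ.filter fun v =>
    4 * s < (comp F v).card ∧ pos v % 2 = 1 ∧ pos v / (2 * s) < blocks F s v

theorem mem_candidates {F : SimpleGraph V} {pos : V → ℕ} {s : ℕ} {v : V} :
    v ∈ candidates F pos s ↔
      4 * s < (comp F v).card ∧ pos v % 2 = 1 ∧ pos v / (2 * s) < blocks F s v := by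
  simp [candidates]

/-- The `- 1` in `blocks` keeps the last position out of all blocks. As position 0 is even,
candidates are inner vertices, and no two are adjacent even around an odd cycle. -/
theorem pos_add_one_lt_of_mem_candidates {F : SimpleGraph V} {pos : V → ℕ} {s : ℕ} (hs : 1 ≤ s)
    {v : V} (hv : v ∈ candidates F pos s) : pos v + 1 < (comp F v).card := by
  obtain ⟨h1, h2, h3⟩ := mem_candidates.1 hv
  rw [Nat.div_lt_iff_lt_mul (by omega), mul_comm] at h3
  have := blocks_mul_le (F := F) (s := s) (v := v)
  omega

theorem IsEnumeration.two_le_valency_of_mem_candidates {F : SimpleGraph V} {pos : V → ℕ}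
    (hpos : IsEnumeration F pos) {s : ℕ} (hs : 1 ≤ s) {v : V} (hv : v ∈ candidates F pos s) :
    2 ≤ valency F v := by
  by_contra hcon
  have h1 := pos_add_one_lt_of_mem_candidates hs hv
  have h2 := (mem_candidates.1 hv).2.1
  rcases hpos.pos_of_valency_le_one (u := v) (by omega) with h | h <;> omega

theorem IsEnumeration.not_adj_of_mem_candidates {F : SimpleGraph V} {pos : V → ℕ}
    (hpos : IsEnumeration F pos) {s : ℕ} {u v : V} (hu : u ∈ candidates F pos s)
    (hv : v ∈ candidates F pos s) : ¬ F.Adj u v := by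
  intro h
  have h1 := (mem_candidates.1 hu).2.1
  have h2 := (mem_candidates.1 hv).2.1
  rcases hpos.of_adj u v h with h | h | h | h <;> omega

theorem IsEnumeration.exists_candidates {F : SimpleGraph V} {pos : V → ℕ}
    (hpos : IsEnumeration F pos) {s : ℕ} (hs : 1 ≤ s) {v : V} (hv : 4 * s < (comp F v).card)
    {j : ℕ} (hj : j < blocks F s v) :
    s ≤ ((candidates F pos s).filter fun u => F.Reachable v u ∧ pos u / (2 * s) = j).card := by
  have hmul : 2 * s * (j + 1) ≤ 2 * s * blocks F s v := Nat.mul_le_mul_left _ hj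
  have hle := blocks_mul_le (F := F) (s := s) (v := v)
  rw [mul_add, mul_one] at hmul
  have hex : ∀ i : ℕ, ∃ u, i < s → F.Reachable v u ∧ pos u = 2 * s * j + (2 * i + 1) := by
    intro i
    by_cases hi : i < s
    · obtain ⟨u, hu⟩ := hpos.surj v (2 * s * j + (2 * i + 1)) (by omega)
      exact ⟨u, fun _ => hu⟩
    · exact ⟨v, fun h => absurd h hi⟩
  choose f hf using hex
  rw [← Finset.card_range s]
  refine Finset.card_le_card_of_injOn f ?_ ?_
  · intro i hi
    obtain ⟨h1, h2⟩ := hf i (by simpa using hi)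
    have hi' : i < s := by simpa using hi
    have h3 : pos (f i) / (2 * s) = j := by
      rw [h2, Nat.mul_add_div (by omega), Nat.div_eq_of_lt (by omega), add_zero]
    refine Finset.mem_coe.2 (Finset.mem_filter.2 ⟨mem_candidates.2 ⟨?_, ?_, ?_⟩, h1, ?_⟩)
    · rwa [Finset.card_range, ← comp_eq_of_reachable h1]
    · have : 2 * s * j = 2 * (s * j) := by ring
      omega
    · rw [Finset.card_range, h3, ← blocks_eq_of_reachable h1]
      exact hj
    · rwa [Finset.card_range]
  · intro i hi i' hi' h
    have h1 := (hf i (by simpa using hi)).2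
    have h2 := (hf i' (by simpa using hi')).2
    rw [h] at h1
    omega

variable {G : SimpleGraph V} {L : V → Finset α} {φ τ : V → α} {k Δ : ℕ}

/-- Haxell's theorem gives a recolourable set that meets every block. -/
theorem Setting.exists_hitting (hset : Setting G L φ τ k Δ) {pos : V → ℕ}
    (hpos : IsEnumeration (monochromaticSubgraph G φ) pos) {s : ℕ} (hs : 1 ≤ s)
    (hs' : 2 * (Δ - 2 * k) ≤ s) :
    ∃ Y ⊆ candidates (monochromaticSubgraph G φ) pos s, IsRecolourable G φ Y ∧
      ∀ v, 4 * s < (comp (monochromaticSubgraph G φ) v).card →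
        ∀ j < blocks (monochromaticSubgraph G φ) s v,
          ∃ y ∈ Y, (monochromaticSubgraph G φ).Reachable v y ∧ pos y / (2 * s) = j := by
  set K := candidates (monochromaticSubgraph G φ) pos s with hK
  have hKval : ∀ v ∈ K, colourCount G φ v (φ v) = 2 := fun v hv => by
    rw [← valency_monochromaticSubgraph]
    exact le_antisymm (hset.valency_le_two v) (hpos.two_le_valency_of_mem_candidates hs hv)
  by_cases hV : Nonempty V
  swap
  · exact ⟨∅, by simp, ⟨by simp, by simp⟩, fun v => absurd ⟨v⟩ hV⟩
  let H : SimpleGraph V :=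
    { Adj := fun u v => G.Adj u v ∧ u ∈ K ∧ v ∈ K
      symm := ⟨fun _ _ h => ⟨h.1.symm, h.2.2, h.2.1⟩⟩
      loopless := ⟨fun _ h => h.1.ne rfl⟩ }
  have hdeg : ∀ w, (Finset.univ.filter fun u => H.Adj w u).card ≤ Δ - 2 * k := by
    intro w
    by_cases hw : w ∈ K
    · refine le_trans (Finset.card_le_card ?_) (card_neighbours_le hset.opt hset.target
        hset.card_list hset.valency_le hKval
        (fun v hv w hw => hpos.not_adj_of_mem_candidates hv hw) hw)
      intro u hu
      simp only [Finset.mem_filter, Finset.mem_univ, true_and] at hu ⊢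
      exact ⟨hu.1, hu.2.2⟩
    · have : (Finset.univ.filter fun u => H.Adj w u) = ∅ :=
        Finset.filter_eq_empty_iff.2 fun u _ h => hw h.2.1
      rw [this]
      simp
  -- The classes are the blocks, with at least s ≥ 2(Δ - 2k) candidates each.
  let cls : V → Finset V × ℕ := fun v => (comp (monochromaticSubgraph G φ) v, pos v / (2 * s))
  obtain ⟨f, hf1, hf2⟩ := exists_independent_transversal H cls K (Δ - 2 * k)
    (fun w => by convert hdeg w) (K.image cls)
    (by
      intro i hi
      obtain ⟨v, hv, rfl⟩ := Finset.mem_image.1 hi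
      refine ⟨⟨v, hv, rfl⟩, hs'.trans ?_⟩
      obtain ⟨h1, -, h3⟩ := mem_candidates.1 hv
      refine (hpos.exists_candidates hs h1 h3).trans (Finset.card_le_card ?_)
      intro u hu
      obtain ⟨h4, h5, h6⟩ := Finset.mem_filter.1 hu
      have hcls : cls u = cls v := Prod.ext (comp_eq_of_reachable h5.symm) h6
      have hboth : u ∈ K ∧ cls u = cls v := ⟨h4, hcls⟩
      simpa using hboth) hV
  refine ⟨(K.image cls).image f, ?_, ⟨?_, ?_⟩, ?_⟩
  · intro y hy
    obtain ⟨i, hi, rfl⟩ := Finset.mem_image.1 hy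
    exact (hf1 i hi).1
  · intro y hy
    obtain ⟨i, hi, rfl⟩ := Finset.mem_image.1 hy
    exact hKval _ (hf1 i hi).1
  · intro y hy y' hy' h
    obtain ⟨i, hi, rfl⟩ := Finset.mem_image.1 hy
    obtain ⟨i', hi', rfl⟩ := Finset.mem_image.1 hy'
    exact hf2 i hi i' hi' ⟨h, (hf1 i hi).1, (hf1 i' hi').1⟩
  · intro v hv j hj
    have h1 := hpos.exists_candidates hs hv hj
    obtain ⟨u, hu⟩ := Finset.card_pos.1 (lt_of_lt_of_le hs h1)
    obtain ⟨h4, h5, h6⟩ := Finset.mem_filter.1 hu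
    have hmem : cls u ∈ K.image cls := Finset.mem_image_of_mem _ h4
    have h7 := (hf1 _ hmem).2
    have h8 := congrArg Prod.fst h7
    have h9 := congrArg Prod.snd h7
    refine ⟨f (cls u), Finset.mem_image_of_mem _ hmem, ?_, h9.trans h6⟩
    exact h5.trans (reachable_iff_comp_eq.2 h8).symm

/-- Among five cyclically consecutive residues there are two consecutive ones that form one of the
pairs `{2 * c, 2 * c + 1}` below `b`. -/
theorem exists_pair_in_window {h b M : ℕ} (hb : b % 2 = 0) (hbh : b ≤ h) (hhb : h ≤ b + 2)
    (hb2 : 2 ≤ b) (hM : M < h) :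
    ∃ i ≤ 3, (M + i) % h % 2 = 0 ∧ (M + i) % h + 1 < b ∧ (M + i + 1) % h = (M + i) % h + 1 := by
  have aux : ∀ i, M + i + 1 < h → (M + i) % 2 = 0 → M + i + 1 < b → i ≤ 3 →
      ∃ i ≤ 3, (M + i) % h % 2 = 0 ∧ (M + i) % h + 1 < b ∧
        (M + i + 1) % h = (M + i) % h + 1 := by
    intro i h1 h2 h3 h4
    refine ⟨i, h4, ?_⟩
    rw [Nat.mod_eq_of_lt h1, Nat.mod_eq_of_lt (show M + i < h by omega)]
    exact ⟨h2, h3, rfl⟩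
  -- A pair starts at M or M + 1 unless the end is near; then the wrap to the pair {0, 1} at i = h -
  -- M is in reach.
  by_cases hw : h - M ≤ 3
  · by_cases h1 : M + 1 < b ∧ M % 2 = 0
    · exact aux 0 (by omega) (by omega) (by omega) (by omega)
    · by_cases h2 : M + 2 < b ∧ M % 2 = 1
      · exact aux 1 (by omega) (by omega) (by omega) (by omega)
      · refine ⟨h - M, hw, ?_⟩
        rw [show M + (h - M) = h by omega, Nat.mod_self,
          show h + 1 = 1 + h by omega, Nat.add_mod_right, Nat.mod_eq_of_lt (show 1 < h by omega)]
        omega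
  · rcases Nat.mod_two_eq_zero_or_one M with h1 | h1
    · exact aux 0 (by omega) (by omega) (by omega) (by omega)
    · exact aux 1 (by omega) (by omega) (by omega) (by omega)

/-- A choice of pairs of blocks in each component with more than `4 * s` vertices, such that the
block of a vertex of `R` is in no pair, and every set that meets every pair meets all components in
many places. -/
theorem exists_selection {F : SimpleGraph V} {pos : V → ℕ} {s : ℕ} (hs : 1 ≤ s) {Y R : Finset V}
    (hY : Y ⊆ candidates F pos s)
    (hYhit : ∀ v, 4 * s < (comp F v).card → ∀ j < blocks F s v,
      ∃ y ∈ Y, F.Reachable v y ∧ pos y / (2 * s) = j)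
    (hR : R ⊆ Y) (hRcyc : ∀ r ∈ R, comp F r ∈ cyclicComps F)
    (hRuniq : ∀ r ∈ R, ∀ r' ∈ R, F.Reachable r r' → r = r') :
    ∃ Y' ⊆ Y, Disjoint R Y' ∧ ∃ κ : V → Finset V × ℕ,
      (∀ y ∈ Y', ∃ y' ∈ Y', y' ≠ y ∧ κ y' = κ y) ∧
      ∀ X ⊆ Y', (∀ y ∈ Y', ∃ x ∈ X, κ x = κ y) →
        (∀ v, 4 * s < (comp F v).card → 5 ≤ blocks F s v → ∀ j, ∃ i ≤ 4, ∃ x ∈ X,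
          F.Reachable v x ∧ pos x / (2 * s) = (j + i) % blocks F s v) ∧
        (∀ v, 4 * s < (comp F v).card → comp F v ∉ cyclicComps F →
          (∃ x ∈ X, F.Reachable v x ∧ pos x / (2 * s) ≤ 2) ∧
          ∃ x ∈ X, F.Reachable v x ∧ blocks F s v ≤ pos x / (2 * s) + 2) := by
  -- The block of the vertex of `R` in the component. The default 0 is harmless: it leaves an
  -- arbitrary block unpaired.
  let z : Finset V → ℕ := fun C =>
    if h : ∃ r ∈ R, comp F r = C then pos h.choose / (2 * s) else 0
  -- Blocks are renumbered by `m`, a rotation by `a`, and those with number below the even `b` are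
  -- paired as {2c, 2c + 1}. In a cyclic component the last number is never paired.
  let b : V → ℕ := fun v =>
    if comp F v ∈ cyclicComps F then 2 * ((blocks F s v - 1) / 2) else 2 * (blocks F s v / 2)
  -- In a cyclic component this rotates the block `z` to the last number. In the others an odd
  -- number of blocks leaves block 0 unpaired, so that the last two blocks form a pair.
  let a : V → ℕ := fun v =>
    if comp F v ∈ cyclicComps F then blocks F s v - 1 - z (comp F v)
    else (blocks F s v % 2) * (blocks F s v - 1)
  let m : V → ℕ := fun v => (pos v / (2 * s) + a v) % blocks F s v
  let κ : V → Finset V × ℕ := fun v => (comp F v, m v / 2)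
  have hbr : ∀ u v, F.Reachable u v → b u = b v := fun u v h => by
    simp only [b, comp_eq_of_reachable h, blocks_eq_of_reachable h]
  have har : ∀ u v, F.Reachable u v → a u = a v := fun u v h => by
    simp only [a, comp_eq_of_reachable h, blocks_eq_of_reachable h]
  have hbeven : ∀ v, b v % 2 = 0 := fun v => by
    simp only [b]
    split_ifs <;> omega
  have hble : ∀ v, b v ≤ blocks F s v := fun v => by
    simp only [b]
    split_ifs <;> omega
  have hleb : ∀ v, 2 ≤ blocks F s v → blocks F s v ≤ b v + 2 := fun v hv => by
    simp only [b]
    split_ifs <;> omega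
  have hale : ∀ v, a v ≤ blocks F s v - 1 := fun v => by
    simp only [a]
    split_ifs
    · omega
    · rcases Nat.mod_two_eq_zero_or_one (blocks F s v) with h | h <;> rw [h] <;> omega
  set Y' := Y.filter fun y => m y < b y with hY'
  have hmem : ∀ v, 4 * s < (comp F v).card → ∀ c < b v,
      ∃ y ∈ Y', F.Reachable v y ∧ m y = c := by
    intro v hv c hc
    have h2 := two_le_blocks hs hv
    have h3 := hale v
    have h4 := hble v
    obtain ⟨y, hy, hvy, hyc⟩ := hYhit v hv ((c + (blocks F s v - a v)) % blocks F s v)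
      (Nat.mod_lt _ (by omega))
    have hm : m y = c := by
      simp only [m]
      rw [← har v y hvy, ← blocks_eq_of_reachable hvy, hyc, Nat.mod_add_mod,
        show c + (blocks F s v - a v) + a v = c + blocks F s v by omega, Nat.add_mod_right,
        Nat.mod_eq_of_lt (by omega)]
    refine ⟨y, Finset.mem_filter.2 ⟨hy, ?_⟩, hvy, hm⟩
    rw [hm, ← hbr v y hvy]
    exact hc
  have hchosen : ∀ X ⊆ Y', (∀ y ∈ Y', ∃ x ∈ X, κ x = κ y) → ∀ v, 4 * s < (comp F v).card →
      ∀ c < b v, ∃ x ∈ X, F.Reachable v x ∧ m x / 2 = c / 2 := by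
    intro X hX hX' v hv c hc
    obtain ⟨y, hy, hvy, hyc⟩ := hmem v hv c hc
    obtain ⟨x, hx, hxy⟩ := hX' y hy
    have h1 := congrArg Prod.fst hxy
    have h2 := congrArg Prod.snd hxy
    refine ⟨x, hx, hvy.trans (reachable_iff_comp_eq.2 h1).symm, ?_⟩
    rw [← hyc]
    exact h2
  have hblock : ∀ y ∈ Y, pos y / (2 * s) < blocks F s y := fun y hy =>
    (mem_candidates.1 (hY hy)).2.2
  refine ⟨Y', Finset.filter_subset _ _, ?_, κ, ?_, ?_⟩
  · rw [Finset.disjoint_left]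
    intro r hr hr'
    have h1 := (Finset.mem_filter.1 hr').2
    have hcyc := hRcyc r hr
    have hz : z (comp F r) = pos r / (2 * s) := by
      have hex : ∃ r' ∈ R, comp F r' = comp F r := ⟨r, hr, rfl⟩
      simp only [z, dif_pos hex]
      rw [hRuniq hex.choose hex.choose_spec.1 r hr (reachable_iff_comp_eq.2 hex.choose_spec.2)]
    have h2 := hblock r (hR hr)
    simp only [m, a, b, if_pos hcyc, hz] at h1
    rw [show pos r / (2 * s) + (blocks F s r - 1 - pos r / (2 * s)) = blocks F s r - 1 by omega,
      Nat.mod_eq_of_lt (by omega)] at h1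
    omega
  · intro y hy
    obtain ⟨hyY, hym⟩ := Finset.mem_filter.1 hy
    have hyl := (mem_candidates.1 (hY hyY)).1
    have hbe := hbeven y
    obtain ⟨c, hc, hc1, hc2⟩ : ∃ c < b y, c ≠ m y ∧ c / 2 = m y / 2 := by
      rcases Nat.mod_two_eq_zero_or_one (m y) with h | h
      · exact ⟨m y + 1, by omega, by omega, by omega⟩
      · exact ⟨m y - 1, by omega, by omega, by omega⟩
    obtain ⟨y', hy', hyy', hy'c⟩ := hmem y hyl c hc
    refine ⟨y', hy', ?_, ?_⟩
    · rintro rfl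
      exact hc1 hy'c.symm
    · refine Prod.ext (comp_eq_of_reachable hyy').symm ?_
      simp only [κ, hy'c, hc2]
  · intro X hX hX'
    have hXblock : ∀ x ∈ X, pos x / (2 * s) < blocks F s x := fun x hx =>
      hblock x (Finset.mem_filter.1 (hX hx)).1
    have hmx : ∀ v x, F.Reachable v x → x ∈ X → ∀ t, m x = (t + a v) % blocks F s v →
        pos x / (2 * s) = t % blocks F s v := by
      intro v x hvx hx t ht
      have h1 := hXblock x hx
      simp only [m] at ht
      rw [← har v x hvx, ← blocks_eq_of_reachable hvx] at ht
      rw [← blocks_eq_of_reachable hvx] at h1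
      have h2 := Nat.ModEq.add_right_cancel' (a v) ht
      rw [← h2]
      exact (Nat.mod_eq_of_lt h1).symm
    constructor
    · intro v hv hblk j
      have h2 := two_le_blocks hs hv
      obtain ⟨i, hi, hi1, hi2, hi3⟩ := exists_pair_in_window (h := blocks F s v) (b := b v)
        (M := (j + a v) % blocks F s v) (hbeven v) (hble v) (hleb v h2)
        (by have := hleb v h2; omega) (Nat.mod_lt _ (by omega))
      obtain ⟨x, hx, hvx, hxc⟩ := hchosen X hX hX' v hv _ (show _ < b v by omega)
      have hcase : m x = (((j + a v) % blocks F s v) + i) % blocks F s v ∨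
          m x = (((j + a v) % blocks F s v) + i + 1) % blocks F s v := by omega
      rcases hcase with h | h
      · refine ⟨i, by omega, x, hx, hvx, hmx v x hvx hx (j + i) ?_⟩
        rw [h, Nat.mod_add_mod]
        congr 1
        omega
      · refine ⟨i + 1, by omega, x, hx, hvx, hmx v x hvx hx (j + (i + 1)) ?_⟩
        rw [h, add_assoc, Nat.mod_add_mod]
        congr 1
        omega
    · intro v hv hcyc
      have h2 := two_le_blocks hs hv
      have hbv : b v = 2 * (blocks F s v / 2) := by simp only [b, if_neg hcyc]
      have hav : a v = (blocks F s v % 2) * (blocks F s v - 1) := by simp only [a, if_neg hcyc]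
      have hval : ∀ x ∈ X, F.Reachable v x →
          pos x / (2 * s) = (m x + blocks F s v % 2) % blocks F s v := by
        intro x hx hvx
        rw [← Nat.mod_eq_of_lt (hXblock x hx), ← blocks_eq_of_reachable hvx]
        symm
        rcases Nat.mod_two_eq_zero_or_one (blocks F s v) with h | h
        · simp only [m]
          rw [← har v x hvx, hav, h, ← blocks_eq_of_reachable hvx]
          simp
        · simp only [m]
          rw [← har v x hvx, hav, h, ← blocks_eq_of_reachable hvx, Nat.mod_add_mod,
            show pos x / (2 * s) + 1 * (blocks F s v - 1) + 1 =
              pos x / (2 * s) + blocks F s v by omega, Nat.add_mod_right]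
      constructor
      · obtain ⟨x, hx, hvx, hxc⟩ := hchosen X hX hX' v hv 0 (by omega)
        refine ⟨x, hx, hvx, ?_⟩
        rw [hval x hx hvx]
        refine (Nat.mod_le _ _).trans ?_
        omega
      -- The pair of numbers b - 2 and b - 1 consists of the last two blocks.
      · obtain ⟨x, hx, hvx, hxc⟩ := hchosen X hX hX' v hv (b v - 2) (by omega)
        refine ⟨x, hx, hvx, ?_⟩
        have hmb : m x < b v := by
          rw [hbr v x hvx]
          exact (Finset.mem_filter.1 (hX hx)).2
        rw [hval x hx hvx, Nat.mod_eq_of_lt (by omega)]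
        omega

end Halves

/-! ### Sizes of the pieces left by the cuts -/

section Pieces

variable {V : Type*} [Fintype V] {F : SimpleGraph V} {pos : V → ℕ} {s : ℕ}

/-- Walks in `F` that avoid `X` cannot leave `S`. -/
def IsClosedOff (F : SimpleGraph V) (X S : Finset V) : Prop :=
  ∀ u ∈ S, ∀ w, F.Adj u w → w ∉ X → w ∈ S

theorem IsEnumeration.card_le_of_mapsTo (hpos : IsEnumeration F pos) {v : V} {S : Finset V}
    (T : Finset ℕ) (hS : ∀ u ∈ S, F.Reachable v u ∧ pos u ∈ T) : S.card ≤ T.card :=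
  Finset.card_le_card_of_injOn pos (fun u hu => (hS u hu).2) fun u hu w hw h =>
    hpos.inj u w ((hS u hu).1.symm.trans (hS w hw).1) h

theorem isClosedOff_comp (X : Finset V) (v : V) : IsClosedOff F X (comp F v) := by
  intro u hu w huw _
  rw [mem_comp] at hu ⊢
  exact hu.trans huw.reachable

/-- The first and the last vertex of a component are not adjacent if one of them has degree at most
one. -/
theorem IsEnumeration.not_wrap (hpos : IsEnumeration F pos) {u w : V} (huw : F.Adj u w)
    (hu : pos u = 0) (hw : pos w + 1 = (comp F u).card) (hcard : 3 ≤ (comp F u).card) :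
    2 ≤ valency F u ∧ 2 ≤ valency F w := by
  obtain ⟨a, ha, ha'⟩ := hpos.surj u 1 (by omega)
  obtain ⟨c, hc, hc'⟩ := hpos.surj u (pos w - 1) (by omega)
  constructor
  · exact two_le_valency huw (hpos.adj_succ u a ha (by omega)) (fun h => by subst h; omega)
  · exact two_le_valency huw.symm
      (hpos.adj_succ c w (hc.symm.trans huw.reachable) (by omega)).symm
      (fun h => by subst h; omega)

/-- The piece of a path component that remains at one of its ends. -/
theorem IsEnumeration.exists_closedOff_of_valency_le_one (hpos : IsEnumeration F pos)
    (hs : 1 ≤ s) {X : Finset V} (hX : X ⊆ candidates F pos s)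
    (hend : ∀ v, 4 * s < (comp F v).card → comp F v ∉ cyclicComps F →
      (∃ x ∈ X, F.Reachable v x ∧ pos x / (2 * s) ≤ 2) ∧
      ∃ x ∈ X, F.Reachable v x ∧ blocks F s v ≤ pos x / (2 * s) + 2)
    {v : V} (hv : valency F v ≤ 1) :
    ∃ S : Finset V, v ∈ S ∧ IsClosedOff F X S ∧ S.card ≤ 6 * s ∧
      (4 * s < (comp F v).card → ∀ u ∈ S, valency F u ≤ 1 → u = v) := by
  by_cases hcard : 4 * s < (comp F v).card
  swap
  · exact ⟨comp F v, by simp, isClosedOff_comp X v, by omega, fun h => absurd h hcard⟩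
  have hcyc : comp F v ∉ cyclicComps F := fun h => by
    have := comp_mem_cyclicComps.1 h v (.refl _)
    omega
  obtain ⟨⟨x, hx, hvx, hx2⟩, y, hy, hvy, hy2⟩ := hend v hcard hcyc
  -- If v comes first, its piece ends before x, which lies in one of the first three blocks.
  rcases hpos.pos_of_valency_le_one hv with h0 | h0
  · have hxodd := (mem_candidates.1 (hX hx)).2.1
    have hxlt := pos_add_one_lt_of_mem_candidates hs (hX hx)
    rw [← comp_eq_of_reachable hvx] at hxlt
    have hxle : pos x < 6 * s := by
      have := (Nat.div_lt_iff_lt_mul (show 0 < 2 * s by omega)).1 (Nat.lt_succ_of_le hx2)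
      rw [show Nat.succ 2 * (2 * s) = 6 * s by ring] at this
      exact this
    refine ⟨Finset.univ.filter fun u => F.Reachable v u ∧ pos u < pos x, ?_, ?_, ?_, ?_⟩
    · simp only [Finset.mem_filter, Finset.mem_univ, true_and]
      exact ⟨.refl _, by omega⟩
    · intro u hu w huw hw
      simp only [Finset.mem_filter, Finset.mem_univ, true_and] at hu ⊢
      have hvw := hu.1.trans huw.reachable
      refine ⟨hvw, ?_⟩
      have hne : pos w ≠ pos x := fun h => hw (by
        rw [hpos.inj w x (hvw.symm.trans hvx) h]
        exact hx)
      have hc := comp_eq_of_reachable hu.1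
      rcases hpos.of_adj u w huw with h | h | h | h
      · omega
      · omega
      · exfalso
        have huv := hpos.inj u v hu.1.symm (by omega)
        subst huv
        have := (hpos.not_wrap huw h.1 h.2 (by omega)).1
        omega
      · omega
    · refine (hpos.card_le_of_mapsTo (v := v) (Finset.range (pos x)) ?_).trans ?_
      · intro u hu
        simpa using hu
      · rw [Finset.card_range]
        omega
    · intro _ u hu huv
      simp only [Finset.mem_filter, Finset.mem_univ, true_and] at hu
      rcases hpos.pos_of_valency_le_one huv with h | h
      · exact hpos.inj u v hu.1.symm (by omega)
      · rw [← comp_eq_of_reachable hu.1] at h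
        omega
  · have hylt := pos_add_one_lt_of_mem_candidates hs (hX hy)
    rw [← comp_eq_of_reachable hvy] at hylt
    have hyle : 2 * s * (pos y / (2 * s)) ≤ pos y := Nat.mul_div_le _ _
    have hle := Nat.mul_le_mul_left (2 * s) hy2
    rw [mul_add] at hle
    have hbl := card_le_blocks (F := F) hs v
    -- At most two blocks and the at most 2s positions outside all blocks are involved.
    refine ⟨Finset.univ.filter fun u => F.Reachable v u ∧ pos y < pos u, ?_, ?_, ?_, ?_⟩
    · simp only [Finset.mem_filter, Finset.mem_univ, true_and]
      exact ⟨.refl _, by omega⟩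
    · intro u hu w huw hw
      simp only [Finset.mem_filter, Finset.mem_univ, true_and] at hu ⊢
      have hvw := hu.1.trans huw.reachable
      refine ⟨hvw, ?_⟩
      have hne : pos w ≠ pos y := fun h => hw (by
        rw [hpos.inj w y (hvw.symm.trans hvy) h]
        exact hy)
      have hc := comp_eq_of_reachable hu.1
      rcases hpos.of_adj u w huw with h | h | h | h
      · omega
      · omega
      · omega
      · exfalso
        have huv := hpos.inj u v hu.1.symm (by rw [← hc] at h; omega)
        subst huv
        have := (hpos.not_wrap huw.symm h.1
          (by rw [← comp_eq_of_reachable huw.reachable]; exact h.2)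
          (by rw [← comp_eq_of_reachable huw.reachable]; omega)).2
        omega
    · refine (hpos.card_le_of_mapsTo (v := v) (Finset.Ioo (pos y) (comp F v).card) ?_).trans ?_
      · intro u hu
        simp only [Finset.mem_filter, Finset.mem_univ, true_and] at hu
        have := hpos.lt u
        rw [← comp_eq_of_reachable hu.1] at this
        exact ⟨hu.1, Finset.mem_Ioo.2 ⟨hu.2, this⟩⟩
      · rw [Nat.card_Ioo]
        omega
    · intro _ u hu huv
      simp only [Finset.mem_filter, Finset.mem_univ, true_and] at hu
      rcases hpos.pos_of_valency_le_one huv with h | h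
      · omega
      · rw [← comp_eq_of_reachable hu.1] at h
        exact hpos.inj u v hu.1.symm (by omega)

/-- Every piece of a component is bounded. -/
theorem IsEnumeration.exists_closedOff (hpos : IsEnumeration F pos) (hs : 1 ≤ s) {X : Finset V}
    (hX : X ⊆ candidates F pos s)
    (hwin : ∀ v, 4 * s < (comp F v).card → 5 ≤ blocks F s v → ∀ j, ∃ i ≤ 4, ∃ x ∈ X,
      F.Reachable v x ∧ pos x / (2 * s) = (j + i) % blocks F s v)
    {v : V} (hv : v ∉ X) :
    ∃ S : Finset V, v ∈ S ∧ IsClosedOff F X S ∧ S.card ≤ 14 * s + 2 := by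
  by_cases hcard : (comp F v).card ≤ 14 * s + 2
  · exact ⟨comp F v, by simp, isClosedOff_comp X v, hcard⟩
  have hbl := card_le_blocks (F := F) hs v
  have hblocks : 7 ≤ blocks F s v := by
    by_contra hcon
    have h1 := Nat.mul_le_mul_left (2 * s) (show blocks F s v ≤ 6 by omega)
    omega
  have hw := hwin v (by omega) (by omega)
  set C := X.filter fun x => F.Reachable v x with hC
  have hCmem : ∀ x, x ∈ C ↔ x ∈ X ∧ F.Reachable v x := fun x => by simp [hC]
  have hblk : ∀ x ∈ C, pos x / (2 * s) < blocks F s v := fun x hx => by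
    obtain ⟨h1, h2⟩ := (hCmem x).1 hx
    rw [blocks_eq_of_reachable h2]
    exact (mem_candidates.1 (hX h1)).2.2
  have hlo : ∀ x, 2 * s * (pos x / (2 * s)) ≤ pos x := fun x => Nat.mul_div_le _ _
  have hhi : ∀ x, pos x < 2 * s * (pos x / (2 * s)) + 2 * s := fun x => by
    have := Nat.lt_mul_div_succ (pos x) (show 0 < 2 * s by omega)
    rwa [mul_add, mul_one] at this
  have hmono : ∀ x y, pos x / (2 * s) < pos y / (2 * s) → pos x < pos y := fun x y h =>
    lt_of_not_ge fun hle => absurd (Nat.div_le_div_right (c := 2 * s) hle) (by omega)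
  have hposne : ∀ w, w ∉ X → F.Reachable v w → ∀ x ∈ C, pos w ≠ pos x := fun w hwX hvw x hx h =>
    hwX (by
      obtain ⟨h1, h2⟩ := (hCmem x).1 hx
      rwa [hpos.inj w x (hvw.symm.trans h2) h])
  have hltn : ∀ x ∈ C, pos x + 1 < (comp F v).card := fun x hx => by
    obtain ⟨h1, h2⟩ := (hCmem x).1 hx
    rw [comp_eq_of_reachable h2]
    exact pos_add_one_lt_of_mem_candidates hs (hX h1)
  by_cases hboth : (∃ x ∈ C, pos x < pos v) ∧ ∃ x ∈ C, pos v < pos x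
  · obtain ⟨⟨x0, hx0, hx0v⟩, y0, hy0, hy0v⟩ := hboth
    obtain ⟨x, hx, hxmax⟩ := Finset.exists_max_image (C.filter fun x => pos x < pos v) pos
      ⟨x0, Finset.mem_filter.2 ⟨hx0, hx0v⟩⟩
    obtain ⟨y, hy, hymin⟩ := Finset.exists_min_image (C.filter fun x => pos v < pos x) pos
      ⟨y0, Finset.mem_filter.2 ⟨hy0, hy0v⟩⟩
    obtain ⟨hxC, hxv⟩ := Finset.mem_filter.1 hx
    obtain ⟨hyC, hyv⟩ := Finset.mem_filter.1 hy
    -- The five blocks after that of x contain a cut, and none lies strictly between x and y.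
    have hgap : pos y / (2 * s) ≤ pos x / (2 * s) + 5 := by
      by_contra hcon
      obtain ⟨i, hi, w, hwX, hvw, hwi⟩ := hw (pos x / (2 * s) + 1)
      have hyb := hblk y hyC
      rw [Nat.mod_eq_of_lt (by omega)] at hwi
      have h1 := hmono x w (by omega)
      have h2 := hmono w y (by omega)
      have hwC := (hCmem w).2 ⟨hwX, hvw⟩
      rcases lt_trichotomy (pos w) (pos v) with h | h | h
      · have := hxmax w (Finset.mem_filter.2 ⟨hwC, h⟩)
        omega
      · exact hposne v hv (.refl _) w hwC h.symm
      · have := hymin w (Finset.mem_filter.2 ⟨hwC, h⟩)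
        omega
    refine ⟨Finset.univ.filter fun u => F.Reachable v u ∧ pos x < pos u ∧ pos u < pos y,
      ?_, ?_, ?_⟩
    · simp only [Finset.mem_filter, Finset.mem_univ, true_and]
      exact ⟨.refl _, hxv, hyv⟩
    · intro u hu w huw hwX
      simp only [Finset.mem_filter, Finset.mem_univ, true_and] at hu ⊢
      have hvw := hu.1.trans huw.reachable
      refine ⟨hvw, ?_⟩
      have h1 := hposne w hwX hvw x hxC
      have h2 := hposne w hwX hvw y hyC
      have h3 := hltn y hyC
      have hc := comp_eq_of_reachable hu.1
      rcases hpos.of_adj u w huw with h | h | h | h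
      · omega
      · omega
      · omega
      · rw [← hc] at h
        omega
    · refine (hpos.card_le_of_mapsTo (v := v) (Finset.Ioo (pos x) (pos y)) ?_).trans ?_
      · intro u hu
        simp only [Finset.mem_filter, Finset.mem_univ, true_and] at hu
        exact ⟨hu.1, Finset.mem_Ioo.2 hu.2⟩
      · rw [Nat.card_Ioo]
        have h1 := hlo x
        have h2 := hhi y
        have h3 := Nat.mul_le_mul_left (2 * s) hgap
        rw [mul_add] at h3
        omega
  · obtain ⟨i0, -, w0, hw0X, hvw0, -⟩ := hw 0
    have hw0C := (hCmem w0).2 ⟨hw0X, hvw0⟩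
    obtain ⟨x, hxC, hxmax⟩ := Finset.exists_max_image C pos ⟨w0, hw0C⟩
    obtain ⟨y, hyC, hymin⟩ := Finset.exists_min_image C pos ⟨w0, hw0C⟩
    have hyx := hymin x hxC
    have hyxd := Nat.div_le_div_right (c := 2 * s) hyx
    -- The same around the end of the numbering. Here the at most 2s positions outside all blocks
    -- count too, which raises the bound from 12s to 14s.
    have hgap : pos y / (2 * s) + blocks F s v ≤ pos x / (2 * s) + 5 := by
      by_contra hcon
      obtain ⟨i, hi, w, hwX, hvw, hwi⟩ := hw (pos x / (2 * s) + 1)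
      have hwC := (hCmem w).2 ⟨hwX, hvw⟩
      have h1 := hxmax w hwC
      have h2 := hymin w hwC
      have h3 := Nat.div_le_div_right (c := 2 * s) h1
      have h4 := Nat.div_le_div_right (c := 2 * s) h2
      by_cases hwrap : pos x / (2 * s) + 1 + i < blocks F s v
      · rw [Nat.mod_eq_of_lt hwrap] at hwi
        omega
      · have hxb := hblk x hxC
        rw [show pos x / (2 * s) + 1 + i =
          (pos x / (2 * s) + 1 + i - blocks F s v) + blocks F s v by omega, Nat.add_mod_right,
          Nat.mod_eq_of_lt (by omega)] at hwi
        omega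
    have hvout : pos v < pos y ∨ pos x < pos v := by
      by_contra hcon
      push Not at hcon
      have h1 := hposne v hv (.refl _) x hxC
      have h2 := hposne v hv (.refl _) y hyC
      exact hboth ⟨⟨y, hyC, by omega⟩, x, hxC, by omega⟩
    refine ⟨Finset.univ.filter fun u => F.Reachable v u ∧ (pos u < pos y ∨ pos x < pos u),
      ?_, ?_, ?_⟩
    · simp only [Finset.mem_filter, Finset.mem_univ, true_and]
      exact ⟨.refl _, hvout⟩
    · intro u hu w huw hwX
      simp only [Finset.mem_filter, Finset.mem_univ, true_and] at hu ⊢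
      have hvw := hu.1.trans huw.reachable
      refine ⟨hvw, ?_⟩
      have h1 := hposne w hwX hvw x hxC
      have h2 := hposne w hwX hvw y hyC
      have h3 := hltn x hxC
      have hc := comp_eq_of_reachable hu.1
      rcases hpos.of_adj u w huw with h | h | h | h
      · omega
      · omega
      · rw [← hc] at h
        omega
      · omega
    · refine (hpos.card_le_of_mapsTo (v := v)
        (Finset.range (pos y) ∪ Finset.Ioo (pos x) (comp F v).card) ?_).trans ?_
      · intro u hu
        simp only [Finset.mem_filter, Finset.mem_univ, true_and] at hu
        have := hpos.lt u
        rw [← comp_eq_of_reachable hu.1] at this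
        refine ⟨hu.1, ?_⟩
        simp only [Finset.mem_union, Finset.mem_range, Finset.mem_Ioo]
        omega
      · refine (Finset.card_union_le _ _).trans ?_
        rw [Finset.card_range, Nat.card_Ioo]
        have h1 := hlo x
        have h2 := hhi y
        have h3 := Nat.mul_le_mul_left (2 * s) hgap
        simp only [mul_add] at h3
        have h4 := hltn x hxC
        omega

end Pieces

/-! ### Sparse representatives in the link graph -/

section Sparse

variable {V : Type*} [Fintype V]

/-- A subgraph which has an isolated vertex in every cyclic component has only paths as its
components. -/
theorem IsEnumeration.succ_or_succ_of_adj {M M' : SimpleGraph V} {pos : V → ℕ}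
    (hpos : IsEnumeration M' pos) (hle : M' ≤ M) (hM : ∀ v, valency M v ≤ 2)
    (hcyc : ∀ Z ∈ cyclicComps M, ∃ r ∈ Z, valency M' r = 0) {u v : V} (huv : M'.Adj u v) :
    pos v = pos u + 1 ∨ pos u = pos v + 1 := by
  -- In a component with more than two vertices such an edge closes a cycle. As degrees in M are at
  -- most two, this is a cyclic component of M, which has a vertex isolated in M'.
  have key : ∀ u v, M'.Adj u v → pos u = 0 → pos v + 1 = (comp M' u).card → pos v = pos u + 1 := by
    intro u v huv hu hv
    have hne : pos u ≠ pos v := fun h => huv.ne (hpos.inj u v huv.reachable h)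
    by_cases hcard : (comp M' u).card ≤ 2
    · omega
    exfalso
    have hends := hpos.not_wrap huv hu hv (by omega)
    have hsub : ∀ w, (Finset.univ.filter fun z => M'.Adj w z) ⊆
        Finset.univ.filter fun z => M.Adj w z := fun w z hz => by
      simp only [Finset.mem_filter, Finset.mem_univ, true_and] at hz ⊢
      exact hle hz
    have hval : ∀ w, M'.Reachable u w → 2 ≤ valency M' w := by
      intro w huw
      by_contra hcon
      rcases hpos.pos_of_valency_le_one (show valency M' w ≤ 1 by omega) with h | h
      · have := hpos.inj w u huw.symm (by omega)
        subst this
        exact hcon hends.1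
      · rw [← comp_eq_of_reachable huw] at h
        have := hpos.inj w v (huw.symm.trans huv.reachable) (by omega)
        subst this
        exact hcon hends.2
    have hreach : ∀ w, M.Reachable u w → M'.Reachable u w := by
      intro w huw
      refine mem_of_reachable_of_closed (S := {w | M'.Reachable u w}) ?_
        (SimpleGraph.Reachable.refl u) huw
      intro a ha b hab
      have heq := Finset.eq_of_subset_of_card_le (hsub a) ((hM a).trans (hval a ha))
      have : b ∈ Finset.univ.filter fun z => M'.Adj a z := by
        rw [heq]
        simpa using hab
      exact SimpleGraph.Reachable.trans ha (Finset.mem_filter.1 this).2.reachable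
    obtain ⟨r, hr, hr0⟩ := hcyc (comp M u) (comp_mem_cyclicComps.2 fun w hw =>
      le_antisymm (hM w) ((hval w (hreach w hw)).trans (Finset.card_le_card (hsub w))))
    have := hval r (hreach r (by simpa using hr))
    omega
  rcases hpos.of_adj u v huv with h | h | h | h
  · exact .inl h
  · exact .inr h
  · exact .inl (key u v huv h.1 h.2)
  · exact .inr (key v u huv.symm h.1 (by rw [← comp_eq_of_reachable huv.reachable]; exact h.2))

/-- In a graph whose components are paths, representatives of the classes of `κ` can be chosen such
that they induce a matching which does not contain an isolated edge of the graph. -/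
theorem IsEnumeration.exists_sparse_representatives {A : Type*} {M : SimpleGraph V}
    {pos : V → ℕ} (hpos : IsEnumeration M pos)
    (hM : ∀ u v, M.Adj u v → pos v = pos u + 1 ∨ pos u = pos v + 1) (Y : Finset V) (κ : V → A)
    (hκ : ∀ y ∈ Y, ∃ y' ∈ Y, y' ≠ y ∧ κ y' = κ y) :
    ∃ X ⊆ Y, (∀ y ∈ Y, ∃ x ∈ X, κ x = κ y) ∧
      (∀ x ∈ X, ∀ y ∈ X, ∀ z ∈ X, M.Adj x y → M.Adj y z → x = z) ∧
      ∀ x ∈ X, ∀ y ∈ X, M.Adj x y → ∃ w, (M.Adj x w ∧ w ≠ y) ∨ (M.Adj y w ∧ w ≠ x) := by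
  -- On each path X takes at most one of the positions 2b and 2b + 1. Thus an edge inside X joins
  -- some 2b + 1 to 2b + 2; no second such edge meets it, and position 2b holds a further neighbour.
  obtain ⟨X, hXY, hXκ, hX⟩ := exists_representatives Y κ (fun y => (comp M y, pos y / 2)) hκ (by
    rintro ⟨C, b⟩
    refine le_of_le_of_eq ?_ (Finset.card_pair (show 2 * b ≠ 2 * b + 1 by omega))
    refine Finset.card_le_card_of_injOn pos ?_ ?_
    · intro y hy
      simp only [Finset.coe_filter, Prod.mk.injEq, Set.mem_ofPred_eq] at hy
      simp only [Finset.coe_insert, Finset.coe_singleton, Set.mem_insert_iff,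
        Set.mem_singleton_iff]
      omega
    · intro y hy z hz h
      simp only [Finset.coe_filter, Prod.mk.injEq, Set.mem_ofPred_eq] at hy hz
      exact hpos.inj y z (reachable_iff_comp_eq.2 (hy.2.1.trans hz.2.1.symm)) h)
  have hdiv : ∀ x ∈ X, ∀ y ∈ X, M.Adj x y → pos x / 2 ≠ pos y / 2 := fun x hx y hy hxy h =>
    hxy.ne (hX x hx y hy (by rw [comp_eq_of_reachable hxy.reachable, h]))
  refine ⟨X, hXY, hXκ, ?_, ?_⟩
  · intro x hx y hy z hz hxy hyz
    have h1 := hdiv x hx y hy hxy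
    have h2 := hdiv y hy z hz hyz
    have h3 := hM x y hxy
    have h4 := hM y z hyz
    exact hpos.inj x z (hxy.reachable.trans hyz.reachable) (by omega)
  · have key : ∀ x ∈ X, ∀ y ∈ X, M.Adj x y → pos y = pos x + 1 → ∃ w, M.Adj x w ∧ w ≠ y := by
      intro x hx y hy hxy h
      have h1 := hdiv x hx y hy hxy
      obtain ⟨w, hw, hw'⟩ := hpos.surj x (pos x - 1) (by have := hpos.lt x; omega)
      refine ⟨w, (hpos.adj_succ w x hw.symm (by omega)).symm, fun h => ?_⟩
      subst h
      omega
    intro x hx y hy hxy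
    rcases hM x y hxy with h | h
    · obtain ⟨w, hw⟩ := key x hx y hy hxy h
      exact ⟨w, .inl hw⟩
    · obtain ⟨w, hw⟩ := key y hy x hx hxy.symm h
      exact ⟨w, .inr hw⟩

end Sparse

/-! ### Components after recolouring -/

section Bound

variable {V α : Type*} [Fintype V] {G : SimpleGraph V} {L : V → Finset α} {φ τ : V → α} {k Δ : ℕ}

local notation "𝓜" => monochromaticSubgraph G φ

theorem IsRecolourable.adj_recolour {X : Finset V} (hX : IsRecolourable G φ X) {u w : V}
    (h : (monochromaticSubgraph G (recolour φ τ X)).Adj u w) :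
    (u ∉ X ∧ w ∉ X ∧ (𝓜).Adj u w) ∨ (u ∈ X ∧ w ∉ X ∧ IsArm G φ τ u w) ∨
      (u ∉ X ∧ w ∈ X ∧ IsArm G φ τ w u) := by
  obtain ⟨hadj, hcol⟩ := h
  unfold recolour at hcol
  by_cases hu : u ∈ X
  · have hw : w ∉ X := fun hw => hX.2 u hu w hw hadj
    rw [if_pos hu, if_neg hw] at hcol
    exact .inr (.inl ⟨hu, hw, hadj, hcol.symm⟩)
  · by_cases hw : w ∈ X
    · rw [if_pos hw, if_neg hu] at hcol
      exact .inr (.inr ⟨hu, hw, hadj.symm, hcol⟩)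
    · rw [if_neg hu, if_neg hw] at hcol
      exact .inl ⟨hu, hw, hadj, hcol⟩

theorem IsClosedOff.union {V : Type*} {F : SimpleGraph V} {X S T : Finset V}
    (hS : IsClosedOff F X S) (hT : IsClosedOff F X T) : IsClosedOff F X (S ∪ T) := by
  intro u hu w huw hw
  rcases Finset.mem_union.1 hu with h | h
  · exact Finset.mem_union_left _ (hS u h w huw hw)
  · exact Finset.mem_union_right _ (hT u h w huw hw)

theorem IsClosedOff.inter {V : Type*} {F : SimpleGraph V} {X S T : Finset V}
    (hS : IsClosedOff F X S) (hT : IsClosedOff F X T) : IsClosedOff F X (S ∩ T) := by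
  intro u hu w huw hw
  obtain ⟨h1, h2⟩ := Finset.mem_inter.1 hu
  exact Finset.mem_inter.2 ⟨hS u h1 w huw hw, hT u h2 w huw hw⟩

/-- A closed off set, together with vertices of `X` all of whose arms it contains. -/
theorem IsRecolourable.comp_recolour_subset {X P A : Finset V} (hX : IsRecolourable G φ X)
    (hA : IsClosedOff 𝓜 X A)
    (harm : ∀ x ∈ P, ∀ u, IsArm G φ τ x u → u ∈ A)
    (hback : ∀ u ∈ A, ∀ x ∈ X, IsArm G φ τ x u → x ∈ P) {v : V} (hv : v ∈ P) (hP : P ⊆ X) :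
    comp (monochromaticSubgraph G (recolour φ τ X)) v ⊆ P ∪ A := by
  intro w hw
  -- `A` may contain vertices of `X` lying in the old component; the condition `w ∉ X` keeps the
  -- walk from using them.
  have : w ∈ {w | w ∈ P ∨ w ∈ A ∧ w ∉ X} := by
    refine mem_of_reachable_of_closed ?_ (Or.inl hv) (mem_comp.1 hw)
    intro a ha b hab
    rcases hX.adj_recolour hab with ⟨h1, h2, h3⟩ | ⟨h1, h2, h3⟩ | ⟨h1, h2, h3⟩
    · rcases ha with ha | ha
      · exact absurd (hP ha) h1
      · exact Or.inr ⟨hA a ha.1 b h3 h2, h2⟩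
    · rcases ha with ha | ha
      · exact Or.inr ⟨harm a ha b h3, h2⟩
      · exact absurd h1 ha.2
    · rcases ha with ha | ha
      · exact absurd (hP ha) h1
      · exact Or.inl (hback a ha.1 b h2 h3)
  rcases this with h | h
  · exact Finset.mem_union_left _ h
  · exact Finset.mem_union_right _ h.1

theorem Setting.exists_other_arm (hset : Setting G L φ τ k Δ) {Y : Finset V}
    (hY : IsRecolourable G φ Y) {x u : V} (hx : x ∈ Y) (hu : IsArm G φ τ x u) :
    ∃ u', IsArm G φ τ x u' ∧ ∀ w, IsArm G φ τ x w → w = u ∨ w = u' := by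
  have h1 := hset.card_arms hY hx
  have h2 : u ∈ Finset.univ.filter fun u => IsArm G φ τ x u := by simpa using hu
  obtain ⟨u', hu'⟩ := Finset.card_eq_one.1 (by
    rw [Finset.card_erase_of_mem h2, h1] :
    ((Finset.univ.filter fun u => IsArm G φ τ x u).erase u).card = 1)
  have h3 : ∀ w, w ≠ u ∧ IsArm G φ τ x w ↔ w = u' := fun w => by
    rw [← Finset.mem_singleton, ← hu']
    simp
  refine ⟨u', ((h3 u').2 rfl).2, fun w hw => ?_⟩
  by_cases h : w = u
  · exact .inl h
  · exact .inr ((h3 w).1 ⟨h, hw⟩)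

theorem Setting.exists_arm (hset : Setting G L φ τ k Δ) {Y : Finset V}
    (hY : IsRecolourable G φ Y) {x : V} (hx : x ∈ Y) : ∃ u, IsArm G φ τ x u := by
  have h1 := hset.card_arms hY hx
  obtain ⟨u, hu⟩ := Finset.card_pos.1 (by omega : 0 <
    (Finset.univ.filter fun u => IsArm G φ τ x u).card)
  exact ⟨u, by simpa using hu⟩

/-- The piece at an arm of `x` has arms of other vertices only if its component is small. -/
theorem Setting.exists_piece (hset : Setting G L φ τ k Δ) {X : Finset V}
    (hX : IsRecolourable G φ X) {pos : V → ℕ} (hpos : IsEnumeration 𝓜 pos) {s : ℕ} (hs : 1 ≤ s)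
    (hXc : X ⊆ candidates 𝓜 pos s)
    (hend : ∀ v, 4 * s < (comp 𝓜 v).card → comp 𝓜 v ∉ cyclicComps 𝓜 →
      (∃ x ∈ X, (𝓜).Reachable v x ∧ pos x / (2 * s) ≤ 2) ∧
      ∃ x ∈ X, (𝓜).Reachable v x ∧ blocks 𝓜 s v ≤ pos x / (2 * s) + 2)
    {x u : V} (hx : x ∈ X) (hu : IsArm G φ τ x u) :
    ∃ S : Finset V, u ∈ S ∧ IsClosedOff 𝓜 X S ∧ S.card ≤ 6 * s ∧
      ∀ w ∈ S, ∀ x' ∈ X, x' ≠ x → IsArm G φ τ x' w →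
        (𝓜).Reachable u w ∧ (comp 𝓜 u).card ≤ 4 * s := by
  obtain ⟨S, huS, hS, hcard, hS'⟩ := hpos.exists_closedOff_of_valency_le_one hs hXc hend
    (hset.valency_arm_le_one hX hx hu)
  refine ⟨S ∩ comp 𝓜 u, by simpa using huS, hS.inter (isClosedOff_comp X u),
    (Finset.card_le_card Finset.inter_subset_left).trans hcard, ?_⟩
  intro w hw x' hx' hne hw'
  obtain ⟨hwS, hwu⟩ := Finset.mem_inter.1 hw
  refine ⟨mem_comp.1 hwu, ?_⟩
  -- In a large component the piece contains only the end `u`, which is an arm of x alone.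
  by_contra hcon
  have := hS' (by omega) w hwS (hset.valency_arm_le_one hX hx' hw')
  subst this
  exact hne (hset.eq_of_arm_of_arm hX hpos hx' hx hw' hu (by omega))

/-- If a small component has arms of two vertices of `X`, one of which has a further link, then the
component of these vertices after recolouring is bounded. -/
theorem Setting.card_comp_recolour_le_of_link (hset : Setting G L φ τ k Δ) {Y X : Finset V}
    (hY : IsRecolourable G φ Y) (hXY : X ⊆ Y) {pos : V → ℕ} (hpos : IsEnumeration 𝓜 pos) {s : ℕ}
    (hs : 1 ≤ s) (hXc : X ⊆ candidates 𝓜 pos s)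
    (hend : ∀ v, 4 * s < (comp 𝓜 v).card → comp 𝓜 v ∉ cyclicComps 𝓜 →
      (∃ x ∈ X, (𝓜).Reachable v x ∧ pos x / (2 * s) ≤ 2) ∧
      ∃ x ∈ X, (𝓜).Reachable v x ∧ blocks 𝓜 s v ≤ pos x / (2 * s) + 2)
    (hpath : ∀ x ∈ X, ∀ y ∈ X, ∀ z ∈ X, (linkGraph G φ τ Y (4 * s)).Adj x y →
      (linkGraph G φ τ Y (4 * s)).Adj y z → x = z)
    {x y u w z : V} (hx : x ∈ X) (hy : y ∈ X) (hxy : x ≠ y) (hu : IsArm G φ τ x u)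
    (hw : IsArm G φ τ y w) (huw : (𝓜).Reachable u w) (hsmall : (comp 𝓜 u).card ≤ 4 * s)
    (hxz : (linkGraph G φ τ Y (4 * s)).Adj x z) (hzy : z ≠ y) {v : V} (hv : v = x ∨ v = y) :
    (comp (monochromaticSubgraph G (recolour φ τ X)) v).card ≤ 14 * s + 2 := by
  have hX := hY.mono hXY
  have hinc : ∀ p q, p ∈ Y → IsArm G φ τ p q → (𝓜).Reachable u q → p = x ∨ p = y := by
    intro p q hp hq huq
    by_contra hcon
    push Not at hcon
    have h1 := hset.card_incidences_le hY u
    have h2 : ({x, y, p} : Finset V) ⊆ (incidences G φ τ Y u).image Prod.fst := by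
      intro a ha
      simp only [Finset.mem_insert, Finset.mem_singleton] at ha
      rw [Finset.mem_image]
      rcases ha with rfl | rfl | rfl
      · exact ⟨(a, u), mem_incidences.2 ⟨hXY hx, hu, .refl _⟩, rfl⟩
      · exact ⟨(a, w), mem_incidences.2 ⟨hXY hy, hw, huw⟩, rfl⟩
      · exact ⟨(a, q), mem_incidences.2 ⟨hp, hq, huq⟩, rfl⟩
    have h3 := (Finset.card_le_card h2).trans Finset.card_image_le
    rw [Finset.card_insert_of_notMem (by simp [hxy, hcon.1.symm]),
      Finset.card_pair hcon.2.symm] at h3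
    omega
  have hadj : (linkGraph G φ τ Y (4 * s)).Adj x y :=
    ⟨hxy, hXY hx, hXY hy, u, w, hu, hw, huw, hsmall⟩
  obtain ⟨u', hu', hux⟩ := hset.exists_other_arm hX hx hu
  obtain ⟨w', hw', hwy⟩ := hset.exists_other_arm hX hy hw
  obtain ⟨S, hwS, hS, hScard, hSback⟩ := hset.exists_piece hX hpos hs hXc hend hy hw'
  -- The two incidences in the component of u belong to x and y, so the link from x to z uses the
  -- other arm u'.
  have hu'small : (comp 𝓜 u').card ≤ 4 * s := by
    obtain ⟨hne, -, hzY, a, b, ha, hb, hab, hcard⟩ := hxz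
    rcases hux a ha with rfl | rfl
    · rcases hinc z b hzY hb hab with h | h
      · exact absurd h.symm hne
      · exact absurd h hzy
    · exact hcard
  -- Two vertices, two small components and one end piece: 2 + 4s + 4s + 6s. By `hpath` no other
  -- vertex of `X` has an arm there.
  have hsub := hX.comp_recolour_subset (P := {x, y}) (A := comp 𝓜 u ∪ (comp 𝓜 u' ∪ S)) (τ := τ)
    (v := v) ((isClosedOff_comp X u).union ((isClosedOff_comp X u').union hS))
    (by
      intro p hp q hq
      simp only [Finset.mem_insert, Finset.mem_singleton] at hp
      simp only [Finset.mem_union, mem_comp]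
      rcases hp with rfl | rfl
      · rcases hux q hq with rfl | rfl
        · exact .inl (.refl _)
        · exact .inr (.inl (.refl _))
      · rcases hwy q hq with rfl | rfl
        · exact .inl huw
        · exact .inr (.inr hwS))
    (by
      intro q hq p hp hpq
      simp only [Finset.mem_union, mem_comp] at hq
      simp only [Finset.mem_insert, Finset.mem_singleton]
      rcases hq with hq | hq | hq
      · exact hinc p q (hXY hp) hpq hq
      · by_contra hcon
        push Not at hcon
        exact hcon.2 (hpath p hp x hx y hy
          ⟨hcon.1, hXY hp, hXY hx, q, u', hpq, hu', hq.symm,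
            by rwa [← comp_eq_of_reachable hq]⟩ hadj)
      · by_contra hcon
        push Not at hcon
        obtain ⟨h1, h2⟩ := hSback q hq p hp hcon.2 hpq
        exact hcon.1 (hpath x hx y hy p hp hadj
          ⟨hcon.2.symm, hXY hy, hXY hp, w', q, hw', hpq, h1, h2⟩).symm)
    (by simpa using hv)
    (by
      intro p hp
      simp only [Finset.mem_insert, Finset.mem_singleton] at hp
      rcases hp with rfl | rfl <;> assumption)
  have h1 := Finset.card_le_card hsub
  have h2 := Finset.card_union_le ({x, y} : Finset V) (comp 𝓜 u ∪ (comp 𝓜 u' ∪ S))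
  have h3 := Finset.card_union_le (comp 𝓜 u) (comp 𝓜 u' ∪ S)
  have h4 := Finset.card_union_le (comp 𝓜 u') S
  rw [Finset.card_pair hxy] at h2
  omega

/-- A component avoiding `X` stays within one piece. One with x in `X` either consists of x and
parts of two end pieces, at most 12s + 1 vertices, or contains an arm of a second vertex of `X`;
then `hedge` supplies the further link needed for `Setting.card_comp_recolour_le_of_link`. -/
theorem Setting.card_comp_recolour_le (hset : Setting G L φ τ k Δ) {Y X : Finset V}
    (hY : IsRecolourable G φ Y) (hXY : X ⊆ Y) {pos : V → ℕ} (hpos : IsEnumeration 𝓜 pos) {s : ℕ}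
    (hs : 1 ≤ s) (hXc : X ⊆ candidates 𝓜 pos s)
    (hwin : ∀ v, 4 * s < (comp 𝓜 v).card → 5 ≤ blocks 𝓜 s v → ∀ j, ∃ i ≤ 4, ∃ x ∈ X,
      (𝓜).Reachable v x ∧ pos x / (2 * s) = (j + i) % blocks 𝓜 s v)
    (hend : ∀ v, 4 * s < (comp 𝓜 v).card → comp 𝓜 v ∉ cyclicComps 𝓜 →
      (∃ x ∈ X, (𝓜).Reachable v x ∧ pos x / (2 * s) ≤ 2) ∧
      ∃ x ∈ X, (𝓜).Reachable v x ∧ blocks 𝓜 s v ≤ pos x / (2 * s) + 2)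
    (hpath : ∀ x ∈ X, ∀ y ∈ X, ∀ z ∈ X, (linkGraph G φ τ Y (4 * s)).Adj x y →
      (linkGraph G φ τ Y (4 * s)).Adj y z → x = z)
    (hedge : ∀ x ∈ X, ∀ y ∈ X, (linkGraph G φ τ Y (4 * s)).Adj x y →
      ∃ w, ((linkGraph G φ τ Y (4 * s)).Adj x w ∧ w ≠ y) ∨
        ((linkGraph G φ τ Y (4 * s)).Adj y w ∧ w ≠ x)) (v : V) :
    (comp (monochromaticSubgraph G (recolour φ τ X)) v).card ≤ 14 * s + 2 := by
  have hX := hY.mono hXY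
  by_cases hv : ∃ x ∈ X, (monochromaticSubgraph G (recolour φ τ X)).Reachable v x
  swap
  · push Not at hv
    obtain ⟨S, hvS, hS, hcard⟩ := hpos.exists_closedOff hs hXc hwin
      (fun h => hv v h (.refl _))
    refine (Finset.card_le_card fun w hw => ?_).trans hcard
    refine (mem_of_reachable_of_closed (S := {w | w ∈ S ∧
      (monochromaticSubgraph G (recolour φ τ X)).Reachable v w}) ?_
      ⟨hvS, SimpleGraph.Reachable.refl v⟩ (mem_comp.1 hw)).1
    intro a ha b hab
    have hb := ha.2.trans hab.reachable
    rcases hX.adj_recolour hab with ⟨h1, h2, h3⟩ | ⟨h1, h2, h3⟩ | ⟨h1, h2, h3⟩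
    · exact ⟨hS a ha.1 b h3 h2, hb⟩
    · exact absurd ha.2 (hv a h1)
    · exact absurd hb (hv b h2)
  obtain ⟨x, hx, hvx⟩ := hv
  rw [comp_eq_of_reachable hvx]
  have hlink : ∀ y ∈ X, ∀ u w, y ≠ x → IsArm G φ τ x u → IsArm G φ τ y w →
      (𝓜).Reachable u w → (comp 𝓜 u).card ≤ 4 * s →
      (comp (monochromaticSubgraph G (recolour φ τ X)) x).card ≤ 14 * s + 2 := by
    intro y hy u w hne hu hw huw hsmall
    obtain ⟨z, ⟨h1, h2⟩ | ⟨h1, h2⟩⟩ := hedge x hx y hy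
      ⟨hne.symm, hXY hx, hXY hy, u, w, hu, hw, huw, hsmall⟩
    · exact hset.card_comp_recolour_le_of_link hY hXY hpos hs hXc hend hpath hx hy hne.symm hu hw
        huw hsmall h1 h2 (.inl rfl)
    · exact hset.card_comp_recolour_le_of_link hY hXY hpos hs hXc hend hpath hy hx hne hw hu
        huw.symm (by rwa [← comp_eq_of_reachable huw]) h1 h2 (.inr rfl)
  obtain ⟨u, hu⟩ := hset.exists_arm hX hx
  obtain ⟨u', hu', hux⟩ := hset.exists_other_arm hX hx hu
  obtain ⟨S, huS, hS, hScard, hSback⟩ := hset.exists_piece hX hpos hs hXc hend hx hu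
  obtain ⟨S', huS', hS', hScard', hSback'⟩ := hset.exists_piece hX hpos hs hXc hend hx hu'
  by_cases hfar : ∃ q ∈ S ∪ S', ∃ y ∈ X, y ≠ x ∧ IsArm G φ τ y q
  · obtain ⟨q, hq, y, hy, hne, hyq⟩ := hfar
    rcases Finset.mem_union.1 hq with hq | hq
    · obtain ⟨h1, h2⟩ := hSback q hq y hy hne hyq
      exact hlink y hy u q hne hu hyq h1 h2
    · obtain ⟨h1, h2⟩ := hSback' q hq y hy hne hyq
      exact hlink y hy u' q hne hu' hyq h1 h2
  · push Not at hfar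
    have hsub := hX.comp_recolour_subset (P := {x}) (τ := τ) (v := x) (hS.union hS')
      (by
        intro p hp q hq
        rw [Finset.mem_singleton] at hp
        subst hp
        rcases hux q hq with rfl | rfl
        · exact Finset.mem_union_left _ huS
        · exact Finset.mem_union_right _ huS')
      (by
        intro q hq p hp hpq
        rw [Finset.mem_singleton]
        by_contra hne
        exact hfar q hq p hp hne hpq)
      (Finset.mem_singleton_self x) (Finset.singleton_subset_iff.2 hx)
    have h1 := Finset.card_le_card hsub
    have h2 := Finset.card_union_le {x} (S ∪ S')
    have h3 := Finset.card_union_le S S'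
    rw [Finset.card_singleton] at h2
    omega

end Bound

/-! ### Assembly and the numerical bound -/

section Assembly

variable {V α : Type*} [Fintype V] {G : SimpleGraph V} {L : V → Finset α} {k Δ : ℕ}

theorem exists_isOptimal (hL : ∀ v, (L v).Nonempty) :
    ∃ φ, IsOptimal G L φ ∧ ∀ ψ, IsOptimal G L ψ →
      (cyclicComps (monochromaticSubgraph G ψ)).card ≤
        (cyclicComps (monochromaticSubgraph G φ)).card := by
  choose f hf using hL
  have hne : {φ : V → α | ∀ v, φ v ∈ L v}.Nonempty := ⟨f, hf⟩
  have hopt : {φ : V → α | IsOptimal G L φ}.Nonempty :=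
    ⟨Function.argminOn (energy G) _ hne, Function.argminOn_mem (energy G) _ hne,
      fun ψ hψ => Function.argminOn_le (energy G) {φ : V → α | ∀ v, φ v ∈ L v} hψ⟩
  let g : (V → α) → ℕ := fun φ =>
    Fintype.card (Finset V) - (cyclicComps (monochromaticSubgraph G φ)).card
  refine ⟨Function.argminOn g _ hopt, Function.argminOn_mem g _ hopt, fun ψ hψ => ?_⟩
  have h1 : g (Function.argminOn g _ hopt) ≤ g ψ :=
    Function.argminOn_le g {φ : V → α | IsOptimal G L φ} hψ
  have h2 := Finset.card_le_univ (cyclicComps (monochromaticSubgraph G ψ))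
  have h3 := Finset.card_le_univ
    (cyclicComps (monochromaticSubgraph G (Function.argminOn g _ hopt)))
  simp only [g] at h1 h3 ⊢
  omega

theorem card_comp_le_two {H : SimpleGraph V} (hH : ∀ v, valency H v ≤ 1) (v : V) :
    (comp H v).card ≤ 2 := by
  obtain ⟨pos, hpos⟩ := exists_enumeration fun v => (hH v).trans one_le_two
  by_contra hcon
  obtain ⟨a, ha, ha'⟩ := hpos.surj v 0 (by omega)
  obtain ⟨b, hb, hb'⟩ := hpos.surj v 1 (by omega)
  obtain ⟨c, hc, hc'⟩ := hpos.surj v 2 (by omega)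
  have h1 := hpos.adj_succ a b (ha.symm.trans hb) (by omega)
  have h2 := hpos.adj_succ b c (hb.symm.trans hc) (by omega)
  have h3 := two_le_valency h1.symm h2 (fun h => by subst h; omega)
  have h4 := hH b
  omega

/-- With 2k > Δ an optimal colouring has monochromatic degrees at most one. The case is separate
because 14s + 2 ≥ 16 exceeds the bound 12 for Δ = 3. -/
theorem exists_colouring_of_lt_two_mul (hL : ∀ v, (L v).card = k) (hG : ∀ v, valency G v ≤ Δ)
    (hk : Δ < 2 * k) :
    ∃ φ : V → α, (∀ v, φ v ∈ L v) ∧ ∀ v, (comp (monochromaticSubgraph G φ) v).card ≤ 2 := by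
  obtain ⟨φ, hφ, -⟩ := exists_isOptimal (G := G) (L := L) fun v =>
    Finset.card_pos.1 (by rw [hL]; omega)
  refine ⟨φ, hφ.1, card_comp_le_two fun v => ?_⟩
  rw [valency_monochromaticSubgraph]
  by_contra hcon
  have h1 := sum_colourCount_le (G := G) φ v (L v)
  have h2 : (L v).card • 2 ≤ ∑ c ∈ L v, colourCount G φ v c :=
    Finset.card_nsmul_le_sum _ _ _ fun c hc => by
      have := hφ.colourCount_le hc
      omega
  have h3 := hG v
  rw [smul_eq_mul, hL] at h2
  omega

theorem exists_colouring {s : ℕ} (hL : ∀ v, (L v).card = k) (hG : ∀ v, valency G v ≤ Δ)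
    (hk : Δ + 2 ≤ 3 * k) (hs : 1 ≤ s) (hs' : 2 * (Δ - 2 * k) ≤ s) :
    ∃ φ : V → α, (∀ v, φ v ∈ L v) ∧
      ∀ v, (comp (monochromaticSubgraph G φ) v).card ≤ 14 * s + 2 := by
  obtain ⟨φ, hφ, hmax⟩ := exists_isOptimal (G := G) (L := L) fun v =>
    Finset.card_pos.1 (by rw [hL]; omega)
  obtain ⟨τ, hτ⟩ := hφ.exists_isTarget hL hG hk
  have hset : Setting G L φ τ k Δ := ⟨hφ, hτ, hL, hG, hk⟩
  obtain ⟨pos, hpos⟩ := exists_enumeration hset.valency_le_two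
  obtain ⟨Y, hYc, hY, hYhit⟩ := hset.exists_hitting hpos hs hs'
  obtain ⟨R, hRY, hRhit, hRcyc, hRuniq⟩ := hset.exists_cyclic_representatives hY (m := 4 * s)
    (fun y hy => (mem_candidates.1 (hYc hy)).1)
    (fun Y' hY' => hmax _ (hφ.recolour hτ (hY.mono hY')))
  obtain ⟨Y', hY'Y, hRY', κ, hκ, hsel⟩ := exists_selection hs hYc hYhit hRY hRcyc hRuniq
  have hY' := hY.mono hY'Y
  obtain ⟨posL, hposL⟩ := exists_enumeration (hset.valency_linkGraph_le_two hY' (4 * s))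
  -- `Y'` avoids `R`, so its link graph is a subgraph of that of `Y` with an isolated vertex in
  -- every link cycle, and has only paths as components.
  obtain ⟨X, hXY', hXκ, hpath, hedge⟩ := hposL.exists_sparse_representatives
    (fun u v huv => hposL.succ_or_succ_of_adj (M := linkGraph G φ τ Y (4 * s))
      (fun a b hab => ⟨hab.1, hY'Y hab.2.1, hY'Y hab.2.2.1, hab.2.2.2⟩)
      (hset.valency_linkGraph_le_two hY (4 * s))
      (fun Z hZ => by
        obtain ⟨r, hr, hrZ⟩ := hRhit Z hZ
        refine ⟨r, hrZ, ?_⟩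
        rw [valency, Finset.card_eq_zero, Finset.filter_eq_empty_iff]
        exact fun w _ h => Finset.disjoint_left.1 hRY' hr h.2.1) huv) Y' κ hκ
  obtain ⟨hwin, hend⟩ := hsel X hXY' hXκ
  exact ⟨recolour φ τ X, (hφ.recolour hτ (hY'.mono hXY')).1,
    hset.card_comp_recolour_le hY' hXY' hpos hs ((hXY'.trans hY'Y).trans hYc) hwin hend hpath
      hedge⟩

theorem hasClustering_of_card_comp_le {φ : V → α} {c : ℕ}
    (h : ∀ v, (comp (monochromaticSubgraph G φ) v).card ≤ c) : HasClustering G φ c := by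
  intro C
  induction C using SimpleGraph.ConnectedComponent.ind with
  | h v =>
    have : ((monochromaticSubgraph G φ).connectedComponentMk v).supp =
        (comp (monochromaticSubgraph G φ) v : Set V) := by
      ext w
      rw [SimpleGraph.ConnectedComponent.mem_supp_iff, SimpleGraph.ConnectedComponent.eq,
        Finset.mem_coe, mem_comp, SimpleGraph.reachable_comm]
    rw [this, Set.encard_coe_eq_coe_finsetCard]
    exact_mod_cast h v

theorem choosableWithClustering_of_forall_finset {V : Type u} [Fintype V]
    {G : SimpleGraph V} {k c : ℕ}
    (h : ∀ (α : Type w) (L : V → Finset α), (∀ v, (L v).card = k) →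
      ∃ φ : V → α, (∀ v, φ v ∈ L v) ∧ ∀ v, (comp (monochromaticSubgraph G φ) v).card ≤ c) :
    ChoosableWithClustering.{u, w} G k c := by
  intro α L hL
  have hsub : ∀ v, ∃ S : Finset α, S.card = k ∧ ∀ a ∈ S, a ∈ L v := by
    intro v
    obtain ⟨t, ht, htk⟩ := Set.exists_subset_encard_eq (hL v)
    have hfin := Set.finite_of_encard_eq_coe htk
    refine ⟨hfin.toFinset, ?_, fun a ha => ht (by simpa using ha)⟩
    rw [hfin.encard_eq_coe_toFinset_card] at htk
    exact_mod_cast htk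
  choose S hS hSL using hsub
  obtain ⟨φ, hφ, hcomp⟩ := h α S hS
  exact ⟨φ, fun v => hSL v _ (hφ v), hasClustering_of_card_comp_le hcomp⟩

theorem valency_le_maxDegree [DecidableRel G.Adj] (v : V) : valency G v ≤ G.maxDegree := by
  refine le_trans (le_of_eq ?_) (G.degree_le_maxDegree v)
  rw [← SimpleGraph.card_neighborFinset_eq_degree]
  unfold valency
  congr 1
  ext w
  simp

end Assembly

end ClusteredChoosability

/-- Every finite graph with maximum degree `Δ ≥ 3` is `⌈(Δ + 2) / 3⌉`-choosable with clustering
`⌈19 Δ / 2⌉ - 17` (the subtraction does not truncate, as `⌈19 Δ / 2⌉ ≥ 29`). -/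
theorem mainTheorem7 {V : Type u} [Fintype V] (G : SimpleGraph V) [DecidableRel G.Adj]
    (Δ : ℕ) (hmax : G.maxDegree = Δ) (hΔ : 3 ≤ Δ) :
    ClusteredChoosability.ChoosableWithClustering.{u, w} G
      ⌈(1 / 3 : ℚ) * ((Δ : ℚ) + 2)⌉₊ (⌈(19 / 2 : ℚ) * (Δ : ℚ)⌉₊ - 17) := by
  have hk : Δ + 2 ≤ 3 * ⌈(1 / 3 : ℚ) * ((Δ : ℚ) + 2)⌉₊ := by
    have h := Nat.le_ceil ((1 / 3 : ℚ) * ((Δ : ℚ) + 2))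
    have h' : (Δ : ℚ) + 2 ≤ 3 * (⌈(1 / 3 : ℚ) * ((Δ : ℚ) + 2)⌉₊ : ℚ) := by linarith
    exact_mod_cast h'
  have hc : 19 * Δ ≤ 2 * ⌈(19 / 2 : ℚ) * (Δ : ℚ)⌉₊ := by
    have h := Nat.le_ceil ((19 / 2 : ℚ) * (Δ : ℚ))
    have h' : 19 * (Δ : ℚ) ≤ 2 * (⌈(19 / 2 : ℚ) * (Δ : ℚ)⌉₊ : ℚ) := by linarith
    exact_mod_cast h'
  generalize ⌈(1 / 3 : ℚ) * ((Δ : ℚ) + 2)⌉₊ = k at hk ⊢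
  generalize ⌈(19 / 2 : ℚ) * (Δ : ℚ)⌉₊ = c at hc ⊢
  have hG : ∀ v, ClusteredChoosability.valency G v ≤ Δ := fun v =>
    hmax ▸ ClusteredChoosability.valency_le_maxDegree v
  refine ClusteredChoosability.choosableWithClustering_of_forall_finset fun α L hL => ?_
  by_cases hlt : Δ < 2 * k
  · obtain ⟨φ, hφ, h⟩ := ClusteredChoosability.exists_colouring_of_lt_two_mul hL hG hlt
    exact ⟨φ, hφ, fun v => (h v).trans (by omega)⟩
  -- Here Δ ≥ 2k and 3k ≥ Δ + 2 give Δ ≥ 4 and 3(Δ - 2k) ≤ Δ - 4. So s = 1 or 3s ≤ 2(Δ - 4), and in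
  -- both cases 14s + 2 ≤ 19Δ/2 - 17.
  · obtain ⟨φ, hφ, h⟩ := ClusteredChoosability.exists_colouring hL hG hk
      (le_max_left 1 (2 * (Δ - 2 * k))) (le_max_right _ _)
    exact ⟨φ, hφ, fun v => (h v).trans (by omega)⟩
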